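/- Let $n\ge 0$ be an integer and consider the vertex superalgebra generated by $n$ symplectic boson pairs $(X_i,Y_i)$, Heisenberg currents $h_a$ and ghosts $(b_a,c^a)$, $1\le a\le n-1$, realized on the vacuum Fock space, with $$X_i(z)Y_j(0)\sim\frac{\delta_{ij}}{z},\qquad h_a(z)h_b(0)\sim\frac{C_{ab}}{z^2},\qquad b_a(z)c^b(0)\sim\frac{\delta_a^b}{z},$$ all other OPEs of generators being regular, where $C$ is the Cartan matrix of $\mathfrak{su}(n)$ and $C^{ab}$ are the entries of $C^{-1}$. Products of fields denote nested normally ordered products, $(AB)$ is the normally ordered product, and $A\mapsto QA$ is the action of the BRST charge $$Q=\oint\frac{dz}{2\pi i}\sum_{a=1}^{n-1}c^a\left(X_aY_a-X_{a+1}Y_{a+1}+h_a\right).$$ Write $A\equiv B$ if $A-B$ is $Q$-exact. The stress tensor is $$T=\frac12\sum_{i=1}^n\left(X_i\partial Y_i-\partial X_i\,Y_i\right)+\frac12\sum_{a,b=1}^{n-1}C^{ab}h_ah_b-\sum_{a=1}^{n-1}b_a\partial c^a .$$ Put $\mathcal A_i=-X_iY_i$ and, for an operator $\mathcal O$, $D_i\mathcal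 O=2(\mathcal A_i\mathcal O)+(X_i(Y_i\mathcal O))$, and let $\mathcal X=X_1\cdots X_n$, $\mathcal Y=Y_1\cdots Y_n$. Let $k\ge 0$ with $2k\le n$, let $i_1,\dots,i_{2k}\in\{1,\dots,n\}$ be distinct, and let $P$ be either of $$\prod_{j=1}^{k}\left(D_{i_{2j-1}}-D_{i_{2j}}\right)\mathcal X,\qquad \prod_{j=1}^{k}\left(D_{i_{2j-1}}-D_{i_{2j}}\right)\mathcal Y .$$ Then $P$ is primary of weight $\frac n2+k$ for $T$: $$T(z)P(0)\sim\frac{\left(\frac n2+k\right)P}{z^2}+\frac{\partial P}{z},$$ with no poles of order three or higher. Moreover $QP=0$, and the BRST class of $P$ is primary of the same weight for the class of $T$: for every even operator $T'\equiv T$ of the vertex superalgebra, the same OPE holds with $T'$ in place of $T$, modulo $Q$-exact operators in each coefficient. -/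

import Mathlib

open scoped TensorProduct

namespace BosonicVOA

/-! ## Fields on a complex vector space and their products

A field `A(z) = ∑ₘ A₍ₘ₎ z^(-m-1)` on `V` is a `VertexOperator ℂ V`; its mode `A₍ₘ₎` is
`VertexOperator.ncoeff A m`. -/

section Fields

variable {V : Type*} [AddCommGroup V] [Module ℂ V]

/-- The mode `A₍ₘ₎`. -/
noncomputable abbrev mode (A : VertexOperator ℂ V) (m : ℤ) : Module.End ℂ V :=
  VertexOperator.ncoeff A m

/-- The field with prescribed modes `f m`, where each vector is killed by `f m` for large `m`. -/
noncomputable def ofModes (f : ℤ → Module.End ℂ V)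
    (hf : ∀ v, ∃ N : ℤ, ∀ m, N ≤ m → f m v = 0) : VertexOperator ℂ V :=
  VertexOperator.of_coeff (fun y => f (-y - 1)) (by
    intro v
    obtain ⟨N, hN⟩ := hf v
    refine ⟨-N, fun y hy => ?_⟩
    by_contra h
    exact hy (hN _ (by omega)))

theorem mode_ofModes (f : ℤ → Module.End ℂ V)
    (hf : ∀ v, ∃ N : ℤ, ∀ m, N ≤ m → f m v = 0) (m : ℤ) : mode (ofModes f hf) m = f m := by
  simp [mode, ofModes]

theorem exists_mode_eq_zero (A : VertexOperator ℂ V) (v : V) :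
    ∃ N : ℕ, ∀ m : ℤ, (N : ℤ) ≤ m → mode A m v = 0 := by
  refine ⟨(-((HahnModule.of ℂ).symm (A v)).order).toNat, fun m hm => ?_⟩
  apply VertexOperator.ncoeff_eq_zero_of_lt_order
  have := Int.self_le_toNat (-((HahnModule.of ℂ).symm (A v)).order)
  omega

/-- The Koszul sign `(-1)^(pq)` of two parities. -/
def koszul (p q : ZMod 2) : ℤ := (-1) ^ (p.val * q.val)

/-- The `j`-th summand of the `m`-th mode of the residue product `A₍ₙ₎B`. -/
noncomputable def prodTerm (ε : ℤ) (A B : VertexOperator ℂ V) (n m : ℤ) (j : ℕ) :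
    Module.End ℂ V :=
  ((-1) ^ j * Ring.choose n j : ℤ) •
    (mode A (n - j) * mode B (m + j) -
      (ε * (n.negOnePow : ℤ)) • (mode B (m + n - j) * mode A j))

theorem finite_support_prodTerm (ε : ℤ) (A B : VertexOperator ℂ V) (n m : ℤ) (v : V) :
    (Function.support fun j => prodTerm ε A B n m j v).Finite := by
  obtain ⟨N₁, h₁⟩ := exists_mode_eq_zero A v
  obtain ⟨N₂, h₂⟩ := exists_mode_eq_zero B v
  refine (Set.finite_Iio (max N₁ (N₂ + m.natAbs))).subset fun j hj => ?_
  by_contra h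
  simp only [Set.mem_Iio, not_lt] at h
  exact hj (by simp [prodTerm, h₁ j (by omega), h₂ (m + j) (by omega)])

/-- The `m`-th mode of the residue product. -/
noncomputable def prodMode (ε : ℤ) (A B : VertexOperator ℂ V) (n m : ℤ) : Module.End ℂ V where
  toFun v := ∑ᶠ j : ℕ, prodTerm ε A B n m j v
  map_add' v w := by
    simp only [map_add]
    exact finsum_add_distrib (finite_support_prodTerm ε A B n m v)
      (finite_support_prodTerm ε A B n m w)
  map_smul' c v := by
    simp only [map_smul, RingHom.id_apply]
    exact (smul_finsum' c (finite_support_prodTerm ε A B n m v)).symm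

theorem prodMode_eq_zero (ε : ℤ) (A B : VertexOperator ℂ V) (n : ℤ) (v : V) :
    ∃ N : ℤ, ∀ m, N ≤ m → prodMode ε A B n m v = 0 := by
  obtain ⟨N₁, h₁⟩ := exists_mode_eq_zero A v
  obtain ⟨N₂, h₂⟩ := exists_mode_eq_zero B v
  choose K hK using fun j : ℕ => exists_mode_eq_zero B (mode A j v)
  refine ⟨N₂ + N₁ + n.natAbs + ∑ j ∈ Finset.range N₁, K j, fun m hm => ?_⟩
  change ∑ᶠ j : ℕ, prodTerm ε A B n m j v = 0
  rw [← finsum_zero (α := ℕ)]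
  congr 1
  funext j
  have hs : (0 : ℤ) ≤ ∑ j ∈ Finset.range N₁, (K j : ℤ) :=
    Finset.sum_nonneg fun _ _ => by positivity
  have hn := neg_abs_le n
  have hn' := abs_nonneg n
  have hB : mode B (m + j) v = 0 := h₂ _ (by push_cast at hm; omega)
  by_cases hj : j < N₁
  · have hk : (K j : ℤ) ≤ ∑ j ∈ Finset.range N₁, (K j : ℤ) :=
      Finset.single_le_sum (f := fun j => (K j : ℤ)) (fun _ _ => by positivity)
        (Finset.mem_range.2 hj)
    have := hK j (m + n - j) (by push_cast at hm; omega)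
    simp [prodTerm, hB, this]
  · simp [prodTerm, hB, h₁ j (by omega)]

/-- The residue product of fields of parities `p` and `q`:
`(A₍ₙ₎B)(w) = Res_z ( A(z)B(w) (z-w)ⁿ|_{|z|>|w|} - (-1)^(pq) B(w)A(z) (z-w)ⁿ|_{|w|>|z|} )`,
that is, the contour integral `∮ dz/(2πi) (z-w)ⁿ A(z)B(w)` around `w`. The field `A₍ⱼ₎B`, `j ≥ 0`,
is the coefficient of `(z-w)^(-j-1)` in the OPE of `A(z)` with `B(w)`, and `A₍₋₁₎B` is the normally
ordered product. -/
noncomputable def nprod (p q : ZMod 2) (n : ℤ) (A B : VertexOperator ℂ V) : VertexOperator ℂ V :=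
  ofModes (prodMode (koszul p q) A B n) (prodMode_eq_zero (koszul p q) A B n)

/-- The normally ordered product `(AB)` of two fields of parities `p` and `q`. -/
noncomputable abbrev normal (p q : ZMod 2) (A B : VertexOperator ℂ V) : VertexOperator ℂ V :=
  nprod p q (-1) A B

/-- The derivative `∂A`. -/
noncomputable def deriv (A : VertexOperator ℂ V) : VertexOperator ℂ V :=
  ofModes (fun m => (-m) • mode A (m - 1)) (by
    intro v
    obtain ⟨N, hN⟩ := exists_mode_eq_zero A v
    exact ⟨N + 1, fun m hm => by simp [hN (m - 1) (by omega)]⟩)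

/-- The identity field. -/
noncomputable def oneField (V : Type*) [AddCommGroup V] [Module ℂ V] : VertexOperator ℂ V :=
  ofModes (fun m => if m = -1 then 1 else 0) (by
    intro v
    exact ⟨0, fun m hm => by simp [show m ≠ -1 by omega]⟩)

/-- The field with modes `ann r` for `m = r ≥ 0` and `cre r` for `m = -1-r < 0`. -/
noncomputable def freeField (cre ann : ℕ → Module.End ℂ V)
    (h : ∀ v, ∃ N : ℕ, ∀ r, N ≤ r → ann r v = 0) : VertexOperator ℂ V :=
  ofModes (fun m => match m with
    | Int.ofNat r => ann r
    | Int.negSucc r => cre r) (by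
    intro v
    obtain ⟨N, hN⟩ := h v
    refine ⟨N, fun m hm => ?_⟩
    match m, hm with
    | Int.ofNat r, hm => exact hN r (by simpa using hm)
    | Int.negSucc r, hm => omega)

end Fields

/-! ## The Fock space of the symplectic bosons, the Heisenberg currents and the ghosts -/

/-- Bosonic creation operators: `X_{i,(-1-r)}`, `Y_{i,(-1-r)}` and `h_{a,(-1-r)}`. -/
inductive BosMode (n : ℕ) : Type
  | X (i : Fin n) (r : ℕ)
  | Y (i : Fin n) (r : ℕ)
  | h (a : Fin (n - 1)) (r : ℕ)

/-- Fermionic creation operators: `b_{a,(-1-r)}` and `c^a_{(-1-r)}`. -/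
inductive FerMode (n : ℕ) : Type
  | b (a : Fin (n - 1)) (r : ℕ)
  | c (a : Fin (n - 1)) (r : ℕ)

/-- Polynomials in the bosonic creation operators tensored with the exterior algebra on the
fermionic ones; the vacuum is `1 ⊗ 1`. -/
abbrev Fock (n : ℕ) : Type :=
  MvPolynomial (BosMode n) ℂ ⊗[ℂ] ExteriorAlgebra ℂ (FerMode n →₀ ℂ)

section Modes

variable {n : ℕ}

/-- Multiplication by the variable `s`. -/
noncomputable def bosCre (s : BosMode n) : Module.End ℂ (Fock n) :=
  LinearMap.rTensor _ (LinearMap.mulLeft ℂ (MvPolynomial.X s))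

/-- The partial derivative with respect to the variable `s`. -/
noncomputable def bosAnn (s : BosMode n) : Module.End ℂ (Fock n) :=
  LinearMap.rTensor _ (MvPolynomial.pderiv s).toLinearMap

/-- Exterior multiplication by the generator `s`. -/
noncomputable def ferCre (s : FerMode n) : Module.End ℂ (Fock n) :=
  LinearMap.lTensor _
    (LinearMap.mulLeft ℂ (ExteriorAlgebra.ι ℂ (Finsupp.single s (1 : ℂ))))

/-- Contraction with the dual of the generator `s`. -/
noncomputable def ferAnn (s : FerMode n) : Module.End ℂ (Fock n) :=
  LinearMap.lTensor _
    (CliffordAlgebra.contractLeft (Q := (0 : QuadraticForm ℂ (FerMode n →₀ ℂ)))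
      (Finsupp.lapply s : (FerMode n →₀ ℂ) →ₗ[ℂ] ℂ))

theorem eventually_bosAnn (s : ℕ → BosMode n) (hs : Function.Injective s) (v : Fock n) :
    ∃ N : ℕ, ∀ r, N ≤ r → bosAnn (s r) v = 0 := by
  induction v using TensorProduct.induction_on with
  | zero => exact ⟨0, fun r _ => map_zero _⟩
  | tmul f x =>
    have hfin : (s ⁻¹' (f.vars : Set (BosMode n))).Finite :=
      f.vars.finite_toSet.preimage hs.injOn
    obtain ⟨N, hN⟩ := hfin.bddAbove
    refine ⟨N + 1, fun r hr => ?_⟩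
    have : s r ∉ f.vars := fun h => by
      have := hN (show r ∈ s ⁻¹' (f.vars : Set (BosMode n)) from h)
      omega
    simp [bosAnn, MvPolynomial.pderiv_eq_zero_of_notMem_vars this]
  | add v w hv hw =>
    obtain ⟨N, hN⟩ := hv
    obtain ⟨M, hM⟩ := hw
    exact ⟨max N M, fun r hr => by
      rw [map_add, hN r (by omega), hM r (by omega), add_zero]⟩

theorem eventually_ferAnn (s : ℕ → FerMode n) (hs : Function.Injective s) (v : Fock n) :
    ∃ N : ℕ, ∀ r, N ≤ r → ferAnn (s r) v = 0 := by
  induction v using TensorProduct.induction_on with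
  | zero => exact ⟨0, fun r _ => map_zero _⟩
  | tmul f x =>
    suffices h : ∃ N : ℕ, ∀ r, N ≤ r →
        CliffordAlgebra.contractLeft (Q := (0 : QuadraticForm ℂ (FerMode n →₀ ℂ)))
          (Finsupp.lapply (s r) : (FerMode n →₀ ℂ) →ₗ[ℂ] ℂ) x = 0 by
      obtain ⟨N, hN⟩ := h
      exact ⟨N, fun r hr => by
        rw [ferAnn, LinearMap.lTensor_tmul, hN r hr, TensorProduct.tmul_zero]⟩
    induction x using CliffordAlgebra.left_induction with
    | algebraMap c => exact ⟨0, fun r _ => CliffordAlgebra.contractLeft_algebraMap _ _ _⟩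
    | add x y hx hy =>
      obtain ⟨N, hN⟩ := hx
      obtain ⟨M, hM⟩ := hy
      exact ⟨max N M, fun r hr => by
        rw [map_add, hN r (by omega), hM r (by omega), add_zero]⟩
    | ι_mul x m hx =>
      obtain ⟨N, hN⟩ := hx
      have hfin : (s ⁻¹' (m.support : Set (FerMode n))).Finite :=
        m.support.finite_toSet.preimage hs.injOn
      obtain ⟨M, hM⟩ := hfin.bddAbove
      refine ⟨max N (M + 1), fun r hr => ?_⟩
      have h0 : m (s r) = 0 := by
        by_contra h
        have := hM (show r ∈ s ⁻¹' (m.support : Set (FerMode n)) from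
          Finsupp.mem_support_iff.2 h)
        omega
      rw [CliffordAlgebra.contractLeft_ι_mul, hN r (by omega), Finsupp.lapply_apply, h0]
      simp
  | add v w hv hw =>
    obtain ⟨N, hN⟩ := hv
    obtain ⟨M, hM⟩ := hw
    exact ⟨max N M, fun r hr => by
      rw [map_add, hN r (by omega), hM r (by omega), add_zero]⟩

end Modes

/-! ## The free fields -/

/-- The Cartan matrix `C` of `su(n)`. -/
noncomputable def cartan (n : ℕ) : Matrix (Fin (n - 1)) (Fin (n - 1)) ℂ :=
  (CartanMatrix.A (n - 1)).map (fun x : ℤ => (x : ℂ))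

section FreeFields

variable {n : ℕ}

/-- `X_i(z)`, with `X_i(z) Y_j(0) ∼ δ_ij / z`. -/
noncomputable def fieldX (i : Fin n) : VertexOperator ℂ (Fock n) :=
  freeField (fun r => bosCre (.X i r)) (fun r => bosAnn (.Y i r))
    (eventually_bosAnn _ fun _ _ h => by cases h; rfl)

/-- `Y_i(z)`. -/
noncomputable def fieldY (i : Fin n) : VertexOperator ℂ (Fock n) :=
  freeField (fun r => bosCre (.Y i r)) (fun r => -bosAnn (.X i r)) (by
    intro v
    obtain ⟨N, hN⟩ := eventually_bosAnn (fun r => BosMode.X i r) (fun _ _ h => by cases h; rfl) v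
    exact ⟨N, fun r hr => by simp [hN r hr]⟩)

/-- The annihilation modes of `h_a(z)`: zero for the zero mode and
`∑_b (r+1) C_ab ∂/∂h_{b,(-1-r)}` for the mode `r+1`. -/
noncomputable def heisAnn (a : Fin (n - 1)) : ℕ → Module.End ℂ (Fock n)
  | 0 => 0
  | r + 1 => ∑ b, (((r : ℂ) + 1) * cartan n a b) • bosAnn (.h b r)

/-- `h_a(z)`, with `h_a(z) h_b(0) ∼ C_ab / z²`. -/
noncomputable def fieldH (a : Fin (n - 1)) : VertexOperator ℂ (Fock n) :=
  freeField (fun r => bosCre (.h a r)) (heisAnn a) (by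
    intro v
    choose N hN using fun b : Fin (n - 1) =>
      eventually_bosAnn (fun r => BosMode.h b r) (fun _ _ h => by cases h; rfl) v
    refine ⟨∑ b, N b + 1, fun r hr => ?_⟩
    obtain ⟨r, rfl⟩ : ∃ t, r = t + 1 := ⟨r - 1, by omega⟩
    simp only [heisAnn, LinearMap.sum_apply, LinearMap.smul_apply]
    refine Finset.sum_eq_zero fun b _ => ?_
    have := Finset.single_le_sum (f := N) (fun _ _ => Nat.zero_le _) (Finset.mem_univ b)
    rw [hN b r (by omega), smul_zero])

/-- `b_a(z)`, with `b_a(z) c^b(0) ∼ δ_a^b / z`. -/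
noncomputable def fieldB (a : Fin (n - 1)) : VertexOperator ℂ (Fock n) :=
  freeField (fun r => ferCre (.b a r)) (fun r => ferAnn (.c a r))
    (eventually_ferAnn _ fun _ _ h => by cases h; rfl)

/-- `c^a(z)`. -/
noncomputable def fieldC (a : Fin (n - 1)) : VertexOperator ℂ (Fock n) :=
  freeField (fun r => ferCre (.c a r)) (fun r => ferAnn (.b a r))
    (eventually_ferAnn _ fun _ _ h => by cases h; rfl)

/-- The vertex superalgebra generated by the free fields: `IsOperator p A` says that `A` is an
element of parity `p`. -/
inductive IsOperator : ZMod 2 → VertexOperator ℂ (Fock n) → Prop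
  | one : IsOperator 0 (oneField (Fock n))
  | X (i : Fin n) : IsOperator 0 (fieldX i)
  | Y (i : Fin n) : IsOperator 0 (fieldY i)
  | h (a : Fin (n - 1)) : IsOperator 0 (fieldH a)
  | b (a : Fin (n - 1)) : IsOperator 1 (fieldB a)
  | c (a : Fin (n - 1)) : IsOperator 1 (fieldC a)
  | zero (p : ZMod 2) : IsOperator p 0
  | add {p : ZMod 2} {A B : VertexOperator ℂ (Fock n)} :
      IsOperator p A → IsOperator p B → IsOperator p (A + B)
  | smul {p : ZMod 2} (t : ℂ) {A : VertexOperator ℂ (Fock n)} :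
      IsOperator p A → IsOperator p (t • A)
  | nprod {p q : ZMod 2} (m : ℤ) {A B : VertexOperator ℂ (Fock n)} :
      IsOperator p A → IsOperator q B → IsOperator (p + q) (nprod p q m A B)

end FreeFields

/-! ## BRST charge and stress tensor -/

/-- For a gauge node `a ∈ {1,…,n-1}`, the index `a` of the hypermultiplet on its left. -/
def left {n : ℕ} (a : Fin (n - 1)) : Fin n := ⟨a.val, by omega⟩

/-- For a gauge node `a ∈ {1,…,n-1}`, the index `a + 1` of the hypermultiplet on its right. -/
def right {n : ℕ} (a : Fin (n - 1)) : Fin n := ⟨a.val + 1, by omega⟩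

/-- `J_BRST = ∑_a c^a (X_a Y_a - X_{a+1} Y_{a+1} + h_a)`. -/
noncomputable def brstCurrent (n : ℕ) : VertexOperator ℂ (Fock n) :=
  ∑ a : Fin (n - 1), normal 1 0 (fieldC a)
    (normal 0 0 (fieldX (left a)) (fieldY (left a)) -
      normal 0 0 (fieldX (right a)) (fieldY (right a)) + fieldH a)

/-- The action of the BRST charge `Q = ∮ dz/(2πi) J_BRST(z)` on a field of parity `p`. -/
noncomputable def brst {n : ℕ} (p : ZMod 2) (A : VertexOperator ℂ (Fock n)) :
    VertexOperator ℂ (Fock n) :=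
  nprod 1 p 0 (brstCurrent n) A

/-- `A ≡ B` for operators of parity `p`: the difference is `Q`-exact. -/
def BRSTEquiv {n : ℕ} (p : ZMod 2) (A B : VertexOperator ℂ (Fock n)) : Prop :=
  ∃ C, IsOperator (p + 1) C ∧ A - B = brst (p + 1) C

/-- `T_sb = (1/2) ∑_i (X_i ∂Y_i - ∂X_i Y_i)`. -/
noncomputable def stressSB (n : ℕ) : VertexOperator ℂ (Fock n) :=
  (1 / 2 : ℂ) • ∑ i : Fin n, (normal 0 0 (fieldX i) (deriv (fieldY i)) -
    normal 0 0 (deriv (fieldX i)) (fieldY i))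

/-- `T_h = (1/2) ∑_{a,b} C^{ab} h_a h_b`, with `C^{ab}` the inverse of the Cartan matrix. -/
noncomputable def stressH (n : ℕ) : VertexOperator ℂ (Fock n) :=
  (1 / 2 : ℂ) • ∑ a : Fin (n - 1), ∑ b : Fin (n - 1),
    (cartan n)⁻¹ a b • normal 0 0 (fieldH a) (fieldH b)

/-- `T_bc = - ∑_a b_a ∂c^a`. -/
noncomputable def stressBC (n : ℕ) : VertexOperator ℂ (Fock n) :=
  -∑ a : Fin (n - 1), normal 1 1 (fieldB a) (deriv (fieldC a))

/-- The stress tensor `T = T_sb + T_h + T_bc`. -/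
noncomputable def stressTensor (n : ℕ) : VertexOperator ℂ (Fock n) :=
  stressSB n + stressH n + stressBC n

/-! ## Covariant derivatives and the operators `𝒳`, `𝒴` -/

section Operators

variable {n : ℕ}

/-- `𝒜_i = -X_i Y_i`. -/
noncomputable def gaugeA (i : Fin n) : VertexOperator ℂ (Fock n) :=
  -normal 0 0 (fieldX i) (fieldY i)

/-- `Â_i O = (𝒜_i O)` on even operators `O`. -/
noncomputable def hatA (i : Fin n) (O : VertexOperator ℂ (Fock n)) : VertexOperator ℂ (Fock n) :=
  normal 0 0 (gaugeA i) O

/-- `𝒟_i O = (𝒜_i O) + (X_i (Y_i O))` on even operators `O`. -/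
noncomputable def partialD (i : Fin n) (O : VertexOperator ℂ (Fock n)) :
    VertexOperator ℂ (Fock n) :=
  normal 0 0 (gaugeA i) O + normal 0 0 (fieldX i) (normal 0 0 (fieldY i) O)

/-- The covariant derivative `D_i = 𝒟_i + Â_i`. -/
noncomputable def covD (i : Fin n) : VertexOperator ℂ (Fock n) → VertexOperator ℂ (Fock n) :=
  fun O => partialD i O + hatA i O

/-- The nested normally ordered product `(A₁ (A₂ (⋯ Aₙ)))`. -/
noncomputable def nestedProd (A : Fin n → VertexOperator ℂ (Fock n)) : VertexOperator ℂ (Fock n) :=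
  (List.ofFn A).foldr (fun B O => normal 0 0 B O) (oneField (Fock n))

/-- `𝒳 = X₁ X₂ ⋯ Xₙ`. -/
noncomputable def calX (n : ℕ) : VertexOperator ℂ (Fock n) := nestedProd fieldX

/-- `𝒴 = Y₁ Y₂ ⋯ Yₙ`. -/
noncomputable def calY (n : ℕ) : VertexOperator ℂ (Fock n) := nestedProd fieldY

/-- `∏_{j=1}^k (D_{i_{2j-1}} - D_{i_{2j}}) O`, the factor `j = 1` being applied last.
The sequence `i` is indexed from `0`. -/
noncomputable def diffProd {k : ℕ} (i : Fin (2 * k) → Fin n) (O : VertexOperator ℂ (Fock n)) :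
    VertexOperator ℂ (Fock n) :=
  (List.ofFn fun j : Fin k =>
      covD (i ⟨2 * j.val, by omega⟩) - covD (i ⟨2 * j.val + 1, by omega⟩)).foldr
    (fun D P => D P) O

end Operators

/-! ## Primary fields -/

/-- The even field `O` is primary of weight `w` for the stress tensor `S`:
`S(z) O(0) ∼ w O / z² + ∂O / z`. -/
structure IsPrimary {n : ℕ} (S : VertexOperator ℂ (Fock n)) (w : ℂ)
    (O : VertexOperator ℂ (Fock n)) : Prop where
  first_order : nprod 0 0 0 S O = deriv O
  second_order : nprod 0 0 1 S O = w • O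
  higher_order : ∀ j : ℕ, 2 ≤ j → nprod 0 0 j S O = 0

/-- The even operator `O` is `Q`-closed and its BRST class is primary of weight `w` for the class
of the stress tensor `T`: the OPE `T'(z) O(0) ∼ w O / z² + ∂O / z` holds modulo `Q`-exact operators
for every operator `T' ≡ T`. -/
structure IsBRSTPrimary (n : ℕ) (w : ℂ) (O : VertexOperator ℂ (Fock n)) : Prop where
  mem : IsOperator 0 O
  closed : brst 0 O = 0
  first_order : ∀ T', IsOperator 0 T' → BRSTEquiv 0 T' (stressTensor n) →
    BRSTEquiv 0 (nprod 0 0 0 T' O) (deriv O)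
  second_order : ∀ T', IsOperator 0 T' → BRSTEquiv 0 T' (stressTensor n) →
    BRSTEquiv 0 (nprod 0 0 1 T' O) (w • O)
  higher_order : ∀ T', IsOperator 0 T' → BRSTEquiv 0 T' (stressTensor n) →
    ∀ j : ℕ, 2 ≤ j → BRSTEquiv 0 (nprod 0 0 j T' O) 0

end BosonicVOA

/-!
An OPE with poles of order at most two is encoded by the commutators of modes, and the OPE of `T`
with an operator is allowed a pole of order three, its anomaly.

Let `(X, Y)` be a symplectic boson pair with current `A = -XY`, and let `O` be a primary operator
with `A(z)O(0) ∼ s O / z`, where either `s = 1` and `X` is regular with `O`, or `s = -1` and `Y` is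
regular with `O`. In the OPE of `A` with `DO = (AO) + (X(YO)) + (AO)` the double poles `-O`, `2O`,
`-O` of the three terms cancel, so `DO` again has charge `s`. In the OPE of `T` with `DO` the third
order pole is `2sO`. It is the same for all pairs, so that it cancels in `D_i - D_j`: this operator
preserves primary operators and raises the weight by one. The induction starts from `𝒳` (`s = 1`)
and `𝒴` (`s = -1`), which have weight `n / 2`, and it continues because the `i_m` are distinct: the
factors applied so far do not involve the bosons of the next two pairs.

As all the currents `𝒜_l` act on `P` with the same charge, `P` is regular with the constraints
`X_a Y_a - X_{a+1} Y_{a+1} + h_a`, whence `QP = 0`. Since `Q` is an odd derivation of the residue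
products, changing `T` by a `Q`-exact operator changes the OPE coefficients of `T` with `P` by
`Q`-exact ones.
-/

namespace BosonicVOA

local infixr:70 " ⋆ " => nprod 0 0 (-1)

section Modes

variable {V : Type*} [AddCommGroup V] [Module ℂ V]

theorem field_ext {A B : VertexOperator ℂ V} (h : ∀ m, mode A m = mode B m) : A = B :=
  HVertexOperator.coeff_inj <| funext fun m => by simpa using h (-m - 1)

@[simp]
theorem mode_add (A B : VertexOperator ℂ V) (m : ℤ) : mode (A + B) m = mode A m + mode B m := by
  simp [mode]

@[simp]
theorem mode_smul (t : ℂ) (A : VertexOperator ℂ V) (m : ℤ) : mode (t • A) m = t • mode A m := by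
  simp [mode]

@[simp]
theorem mode_zero (m : ℤ) : mode (0 : VertexOperator ℂ V) m = 0 := by
  simp [mode]

@[simp]
theorem mode_neg (A : VertexOperator ℂ V) (m : ℤ) : mode (-A) m = -mode A m := by
  simp [mode]

@[simp]
theorem mode_sub (A B : VertexOperator ℂ V) (m : ℤ) : mode (A - B) m = mode A m - mode B m := by
  simp [mode]

theorem neg_one_smul_field (A : VertexOperator ℂ V) : (-1 : ℂ) • A = -A :=
  field_ext fun m => by rw [mode_smul, mode_neg, neg_one_smul]

theorem mode_deriv (A : VertexOperator ℂ V) (m : ℤ) :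
    mode (deriv A) m = (-m) • mode A (m - 1) :=
  mode_ofModes _ _ _

theorem mode_oneField (m : ℤ) : mode (oneField V) m = if m = -1 then 1 else 0 :=
  mode_ofModes _ _ _

/-- The derivative `∂` as a linear map. -/
noncomputable def derivLinear : VertexOperator ℂ V →ₗ[ℂ] VertexOperator ℂ V where
  toFun := deriv
  map_add' A B := field_ext fun m => by simp only [mode_deriv, mode_add, smul_add]
  map_smul' t A := field_ext fun m => by
    simp only [mode_deriv, mode_smul, smul_comm t, RingHom.id_apply]

theorem deriv_zero : deriv (0 : VertexOperator ℂ V) = 0 := derivLinear.map_zero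

theorem deriv_add (A B : VertexOperator ℂ V) : deriv (A + B) = deriv A + deriv B :=
  derivLinear.map_add A B

theorem deriv_neg (A : VertexOperator ℂ V) : deriv (-A) = -deriv A := derivLinear.map_neg A

theorem deriv_smul (t : ℂ) (A : VertexOperator ℂ V) : deriv (t • A) = t • deriv A :=
  derivLinear.map_smul t A

theorem deriv_oneField : deriv (oneField V) = 0 :=
  field_ext fun m => by
    rw [mode_deriv, mode_oneField, mode_zero]
    rcases eq_or_ne m 0 with rfl | h
    · simp
    · simp [show m - 1 ≠ -1 by omega]

/-- Multiplication of a field by `z ^ p`. -/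
noncomputable def shift (p : ℤ) : VertexOperator ℂ V →ₗ[ℂ] VertexOperator ℂ V where
  toFun A := ofModes (fun m => mode A (m + p)) fun v => by
    obtain ⟨N, hN⟩ := exists_mode_eq_zero A v
    exact ⟨N - p, fun m hm => hN _ (by omega)⟩
  map_add' A B := field_ext fun m => by simp only [mode_ofModes, mode_add]
  map_smul' t A := field_ext fun m => by simp only [mode_ofModes, mode_smul, RingHom.id_apply]

theorem mode_shift (p : ℤ) (A : VertexOperator ℂ V) (m : ℤ) :
    mode (shift p A) m = mode A (m + p) :=
  mode_ofModes _ _ _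

theorem shift_zero (A : VertexOperator ℂ V) : shift 0 A = A :=
  field_ext fun m => by rw [mode_shift, add_zero]

theorem shift_shift (p r : ℤ) (A : VertexOperator ℂ V) :
    shift p (shift r A) = shift (p + r) A :=
  field_ext fun m => by simp only [mode_shift, add_assoc]

theorem deriv_shift_one (A : VertexOperator ℂ V) :
    deriv (shift 1 A) = shift 1 (deriv A) + A :=
  field_ext fun m => by
    simp only [mode_deriv, mode_shift, mode_add, sub_add_cancel, add_sub_cancel_right]
    module

end Modes

section ResidueProducts

variable {V : Type*} [AddCommGroup V] [Module ℂ V] (p q r : ZMod 2)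

theorem mode_nprod_apply (n m : ℤ) (A B : VertexOperator ℂ V) (v : V) :
    mode (nprod p q n A B) m v = ∑ᶠ j : ℕ, prodTerm (koszul p q) A B n m j v := by
  rw [nprod, mode_ofModes]
  rfl

theorem prodTerm_apply (ε : ℤ) (A B : VertexOperator ℂ V) (n m : ℤ) (j : ℕ) (v : V) :
    prodTerm ε A B n m j v = ((-1) ^ j * Ring.choose n j : ℤ) •
      (mode A (n - j) (mode B (m + j) v) -
        (ε * (n.negOnePow : ℤ)) • mode B (m + n - j) (mode A j v)) :=
  rfl

@[fun_prop]
theorem hasFiniteSupport_prodTerm (ε : ℤ) (A B : VertexOperator ℂ V) (n m : ℤ) (v : V) :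
    Function.HasFiniteSupport fun j => prodTerm ε A B n m j v :=
  finite_support_prodTerm ε A B n m v

/-- The residue product `A₍ₙ₎B` as a bilinear map. -/
noncomputable def nprodBilin (n : ℤ) :
    VertexOperator ℂ V →ₗ[ℂ] VertexOperator ℂ V →ₗ[ℂ] VertexOperator ℂ V :=
  LinearMap.mk₂ ℂ (nprod p q n)
    (fun A B C => field_ext fun m => LinearMap.ext fun v => by
      simp only [mode_add, LinearMap.add_apply, mode_nprod_apply]
      rw [← finsum_add_distrib (hasFiniteSupport_prodTerm ..) (hasFiniteSupport_prodTerm ..)]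
      exact finsum_congr fun j => by
        simp only [prodTerm_apply, mode_add, LinearMap.add_apply, map_add]; module)
    (fun t A B => field_ext fun m => LinearMap.ext fun v => by
      simp only [mode_smul, LinearMap.smul_apply, mode_nprod_apply]
      rw [smul_finsum' t (hasFiniteSupport_prodTerm ..)]
      exact finsum_congr fun j => by
        simp only [prodTerm_apply, mode_smul, LinearMap.smul_apply, map_smul]; module)
    (fun A B C => field_ext fun m => LinearMap.ext fun v => by
      simp only [mode_add, LinearMap.add_apply, mode_nprod_apply]
      rw [← finsum_add_distrib (hasFiniteSupport_prodTerm ..) (hasFiniteSupport_prodTerm ..)]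
      exact finsum_congr fun j => by
        simp only [prodTerm_apply, mode_add, LinearMap.add_apply, map_add]; module)
    (fun t A B => field_ext fun m => LinearMap.ext fun v => by
      simp only [mode_smul, LinearMap.smul_apply, mode_nprod_apply]
      rw [smul_finsum' t (hasFiniteSupport_prodTerm ..)]
      exact finsum_congr fun j => by
        simp only [prodTerm_apply, mode_smul, LinearMap.smul_apply, map_smul]; module)

theorem nprod_add_left (n : ℤ) (A B C : VertexOperator ℂ V) :
    nprod p q n (A + B) C = nprod p q n A C + nprod p q n B C :=
  (nprodBilin p q n).map_add₂ A B C

theorem nprod_add_right (n : ℤ) (A B C : VertexOperator ℂ V) :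
    nprod p q n A (B + C) = nprod p q n A B + nprod p q n A C :=
  (nprodBilin p q n A).map_add B C

theorem nprod_sub_left (n : ℤ) (A B C : VertexOperator ℂ V) :
    nprod p q n (A - B) C = nprod p q n A C - nprod p q n B C :=
  (nprodBilin p q n).map_sub₂ A B C

theorem nprod_sub_right (n : ℤ) (A B C : VertexOperator ℂ V) :
    nprod p q n A (B - C) = nprod p q n A B - nprod p q n A C :=
  (nprodBilin p q n A).map_sub B C

theorem nprod_neg_left (n : ℤ) (A B : VertexOperator ℂ V) :
    nprod p q n (-A) B = -nprod p q n A B :=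
  (nprodBilin p q n).map_neg₂ A B

theorem nprod_neg_right (n : ℤ) (A B : VertexOperator ℂ V) :
    nprod p q n A (-B) = -nprod p q n A B :=
  (nprodBilin p q n A).map_neg B

theorem nprod_smul_left (n : ℤ) (t : ℂ) (A B : VertexOperator ℂ V) :
    nprod p q n (t • A) B = t • nprod p q n A B :=
  (nprodBilin p q n).map_smul₂ t A B

theorem nprod_smul_right (n : ℤ) (t : ℂ) (A B : VertexOperator ℂ V) :
    nprod p q n A (t • B) = t • nprod p q n A B :=
  (nprodBilin p q n A).map_smul t B

theorem nprod_zero_left (n : ℤ) (B : VertexOperator ℂ V) : nprod p q n 0 B = 0 :=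
  (nprodBilin p q n).map_zero₂ B

theorem nprod_zero_right (n : ℤ) (A : VertexOperator ℂ V) : nprod p q n A 0 = 0 :=
  (nprodBilin p q n A).map_zero

theorem nprod_shift_right (n s : ℤ) (A B : VertexOperator ℂ V) :
    nprod p q n A (shift s B) = shift s (nprod p q n A B) :=
  field_ext fun m => LinearMap.ext fun v => by
    simp only [mode_shift, mode_nprod_apply]
    refine finsum_congr fun j => ?_
    simp only [prodTerm_apply, mode_shift]
    rw [add_right_comm m s, show m + s + n - j = m + n - j + s by ring]

theorem finsum_choose_succ_smul {M : Type*} [AddCommGroup M] (n : ℤ) {x : ℕ → M} {N : ℕ}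
    (hx : ∀ j, N ≤ j → x j = 0) :
    ∑ᶠ j : ℕ, ((-1) ^ j * Ring.choose (n + 1) j : ℤ) • x j =
      ∑ᶠ j : ℕ, ((-1) ^ j * Ring.choose n j : ℤ) • (x j - x (j + 1)) := by
  have hsupp : ∀ y : ℕ → M, (∀ j, N ≤ j → y j = 0) →
      y.support ⊆ Finset.range (N + 1) := fun y hy j hj => by
    simp only [Finset.coe_range, Set.mem_Iio]
    by_contra h
    exact hj (hy j (by omega))
  rw [finsum_eq_sum_of_support_subset _ (hsupp _ fun j hj => by rw [hx j hj, smul_zero]),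
    finsum_eq_sum_of_support_subset _ (hsupp _ fun j hj => by
      rw [hx j hj, hx (j + 1) (by omega), sub_zero, smul_zero])]
  simp only [smul_sub, Finset.sum_sub_distrib]
  rw [Finset.sum_range_succ', Finset.sum_range_succ' (fun j => _ • x j),
    Finset.sum_range_succ (fun j => _ • x (j + 1)), hx (N + 1) (by omega), smul_zero, add_zero,
    add_sub_right_comm, ← Finset.sum_sub_distrib]
  simp only [pow_zero, Ring.choose_zero_right, Ring.choose_succ_succ, ← sub_smul]
  congr 1
  exact Finset.sum_congr rfl fun j _ => by congr 1; ring

theorem exists_forall_mode_eq_zero (A B : VertexOperator ℂ V) (m : ℤ) (v : V) :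
    ∃ N : ℕ, (∀ j : ℕ, N ≤ j → mode A j v = 0) ∧ ∀ j : ℕ, N ≤ j → mode B (m + j) v = 0 := by
  obtain ⟨N₁, h₁⟩ := exists_mode_eq_zero A v
  obtain ⟨N₂, h₂⟩ := exists_mode_eq_zero B v
  exact ⟨N₁ + N₂ + m.natAbs, fun j hj => h₁ _ (by omega), fun j hj => h₂ _ (by omega)⟩

theorem nprod_shift_left (n : ℤ) (A B : VertexOperator ℂ V) :
    nprod p q n (shift 1 A) B = nprod p q (n + 1) A B + shift 1 (nprod p q n A B) := by
  rw [← sub_eq_iff_eq_add]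
  refine field_ext fun m => LinearMap.ext fun v => ?_
  obtain ⟨N, hA, hB⟩ := exists_forall_mode_eq_zero A B m v
  let x : ℕ → V := fun j => mode A (n + 1 - j) (mode B (m + j) v) +
    (koszul p q * (n.negOnePow : ℤ)) • mode B (m + n + 1 - j) (mode A j v)
  have hx : ∀ j, N ≤ j → x j = 0 := fun j hj => by simp [x, hA j hj, hB j hj]
  rw [mode_sub, LinearMap.sub_apply, mode_shift]
  simp only [mode_nprod_apply]
  rw [← finsum_sub_distrib (hasFiniteSupport_prodTerm ..) (hasFiniteSupport_prodTerm ..)]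
  refine Eq.trans (finsum_congr fun j => ?_)
    ((finsum_choose_succ_smul n hx).symm.trans (finsum_congr fun j => ?_))
  · simp only [prodTerm_apply, mode_shift, x]
    push_cast
    rw [sub_add_eq_add_sub n, show n + 1 - (j + 1 : ℤ) = n - j by ring, add_right_comm m 1 n,
      show m + n + 1 - (j + 1 : ℤ) = m + n - j by ring, add_right_comm m 1 (j : ℤ),
      ← add_assoc m (j : ℤ)]
    module
  · simp only [prodTerm_apply, x, Int.negOnePow_succ, ← add_assoc m n]
    simp

theorem mode_nprod_zero (m : ℤ) (A B : VertexOperator ℂ V) :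
    mode (nprod p q 0 A B) m = mode A 0 * mode B m - koszul p q • (mode B m * mode A 0) := by
  ext v
  rw [mode_nprod_apply, finsum_eq_single _ 0]
  · simp [prodTerm]
  · intro j hj
    obtain ⟨j, rfl⟩ := Nat.exists_eq_succ_of_ne_zero hj
    simp [prodTerm, Ring.choose_zero_succ]

theorem koszul_mul_self : koszul p q * koszul p q = 1 := by
  revert p q; decide

theorem koszul_add_left : koszul (p + q) r = koszul p r * koszul q r := by
  revert p q r; decide

theorem koszul_add_right : koszul p (q + r) = koszul p q * koszul p r := by
  revert p q r; decide

theorem koszul_comm : koszul p q = koszul q p := by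
  revert p q; decide

theorem nprod_zero_nprod (n : ℤ) (A B C : VertexOperator ℂ V) :
    nprod p (q + r) 0 A (nprod q r n B C) = nprod (p + q) r n (nprod p q 0 A B) C +
      koszul p q • nprod q (p + r) n B (nprod p r 0 A C) := by
  refine field_ext fun m => LinearMap.ext fun v => ?_
  have hsmul : ∀ D : VertexOperator ℂ V, mode (koszul p q • D) m = koszul p q • mode D m :=
    fun D => map_zsmul ((Pi.evalAddMonoidHom _ m).comp VertexOperator.ncoeff.toAddMonoidHom) _ _
  rw [mode_nprod_zero, mode_add, hsmul]
  simp only [LinearMap.sub_apply, LinearMap.add_apply, LinearMap.smul_apply,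
    Module.End.mul_apply, mode_nprod_apply]
  have hA : Function.HasFiniteSupport fun j => mode A 0 (prodTerm (koszul q r) B C n m j v) :=
    (hasFiniteSupport_prodTerm ..).comp (map_zero (mode A 0))
  rw [map_finsum _ (by fun_prop), smul_finsum' _ (by fun_prop), smul_finsum' _ (by fun_prop),
    ← finsum_sub_distrib hA (by fun_prop), ← finsum_add_distrib (by fun_prop) (by fun_prop)]
  refine finsum_congr fun j => ?_
  have hpq := koszul_mul_self p q
  simp only [prodTerm_apply, mode_nprod_zero, LinearMap.sub_apply, LinearMap.smul_apply,
    Module.End.mul_apply, map_sub, map_zsmul, koszul_add_left, koszul_add_right, koszul_comm q p]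
  generalize koszul p q = ε at *
  obtain rfl | rfl := mul_self_eq_one_iff.1 hpq <;> module

theorem nprod_succ (n : ℤ) (A B : VertexOperator ℂ V) :
    nprod p q (n + 1) A B = nprod p q n (shift 1 A) B - shift 1 (nprod p q n A B) := by
  rw [nprod_shift_left, add_sub_cancel_right]

/-- Borcherds' commutator formula. -/
theorem nprod_nprod (m : ℕ) (n : ℤ) (A B C : VertexOperator ℂ V) :
    nprod p (q + r) m A (nprod q r n B C) =
      ∑ i ∈ Finset.range (m + 1),
        m.choose i • nprod (p + q) r (n + m - i) (nprod p q i A B) C +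
      koszul p q • nprod q (p + r) n B (nprod p r m A C) := by
  induction m generalizing A with
  | zero => simpa using nprod_zero_nprod p q r n A B C
  | succ m ih =>
    rw [Nat.cast_succ, nprod_succ, nprod_succ, ih, ih, Finset.sum_choose_succ_nsmul
      (fun i _ => nprod (p + q) r (n + (m + 1) - i) (nprod p q i A B) C), map_add, map_sum]
    have hindex : ∀ i : ℤ, n + (m + 1) - (i + 1) = n + m - i := fun i => by ring
    have hindex_raise : ∀ i : ℤ, n + (m + 1) - i = n + m - i + 1 := fun i => by ring
    simp only [nprod_shift_left, nprod_add_left, nprod_add_right, nprod_shift_right, map_nsmul,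
      map_zsmul, smul_add, Finset.sum_add_distrib, Nat.cast_succ, hindex, hindex_raise,
      nprod_sub_right, smul_sub]
    abel

theorem nprod_deriv_left (m : ℕ) (A B : VertexOperator ℂ V) :
    nprod p q m (deriv A) B = -(m : ℂ) • nprod p q (m - 1) A B := by
  induction m generalizing A with
  | zero => exact field_ext fun k => by simp [mode_nprod_zero, mode_deriv]
  | succ m ih =>
    have h : shift 1 (deriv A) = deriv (shift 1 A) - A := by rw [deriv_shift_one]; abel
    have h' := nprod_shift_left p q (m - 1) A B
    rw [sub_add_cancel] at h'
    rw [Nat.cast_succ, nprod_succ, h, nprod_sub_left, ih, ih, h', map_smul, add_sub_cancel_right]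
    push_cast
    module

theorem prodTerm_neg_one (ε : ℤ) (A B : VertexOperator ℂ V) (m : ℤ) (j : ℕ) (v : V) :
    prodTerm ε A B (-1) m j v =
      mode A (-1 - j) (mode B (m + j) v) + ε • mode B (m - 1 - j) (mode A j v) := by
  have h : ((-1) ^ j * Ring.choose (-1) j : ℤ) = 1 := by
    rw [Ring.choose_neg]
    simp [Ring.choose_natCast, ← mul_pow, Int.negOnePow_def, Units.smul_def]
  rw [prodTerm, h, one_smul]
  simp [sub_eq_add_neg]

theorem deriv_normal (A B : VertexOperator ℂ V) :
    deriv (normal p q A B) = normal p q (deriv A) B + normal p q A (deriv B) := by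
  rw [← sub_eq_zero, ← sub_sub]
  refine field_ext fun m => LinearMap.ext fun v => ?_
  obtain ⟨N, hA, hB⟩ := exists_forall_mode_eq_zero A B (m - 1) v
  let x : ℕ → V := fun j => (j : ℤ) • (mode A (-1 - j) (mode B (m - 1 + j) v) +
    koszul p q • mode B (m - 1 - j) (mode A (j - 1) v))
  have hx : ∀ j, N + 1 ≤ j → x j = 0 := fun j hj => by
    have := hA (j - 1) (by omega)
    rw [Nat.cast_pred (by omega)] at this
    simp [x, this, hB j (by omega)]
  simp only [mode_sub, LinearMap.sub_apply, mode_deriv, LinearMap.smul_apply, mode_nprod_apply,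
    mode_zero, LinearMap.zero_apply]
  rw [smul_finsum' _ (by fun_prop), ← finsum_sub_distrib (by fun_prop) (by fun_prop),
    ← finsum_sub_distrib (by fun_prop) (by fun_prop)]
  refine (finsum_congr fun j => ?_).trans ((finsum_choose_succ_smul (-1) hx).symm.trans
    (finsum_eq_zero_of_forall_eq_zero fun j => ?_))
  · simp only [prodTerm_apply, mode_deriv, x, LinearMap.smul_apply, map_zsmul]
    push_cast
    rw [show -1 - (j : ℤ) - 1 = -1 - (j + 1) by ring, show m - 1 + ((j : ℤ) + 1) = m + j by ring,
      show m + (j : ℤ) - 1 = m - 1 + j by ring, show m - 1 - ((j : ℤ) + 1) = m - 1 + -1 - j by ring,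
      show (j : ℤ) + 1 - 1 = j by ring, show m + -1 - (j : ℤ) - 1 = m - 1 + -1 - j by ring,
      show m - 1 - (j : ℤ) = m + -1 - j by ring, Int.negOnePow_neg, Int.negOnePow_one]
    push_cast
    module
  · rcases j with - | j
    · simp [x]
    · simp [Ring.choose_zero_succ]

end ResidueProducts

section EvenProducts

variable {V : Type*} [AddCommGroup V] [Module ℂ V]

theorem normal_one (A : VertexOperator ℂ V) : A ⋆ oneField V = A := by
  refine field_ext fun m => LinearMap.ext fun v => ?_
  simp only [mode_nprod_apply, prodTerm_neg_one, mode_oneField, koszul]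
  obtain hm | hm := lt_or_ge m 0
  · rw [finsum_eq_single _ (-1 - m).toNat fun j hj => by
      rw [if_neg (by omega), if_neg (by omega)]; simp]
    rw [if_pos (by omega), if_neg (by omega), Int.toNat_of_nonneg (by omega)]
    simp
  · rw [finsum_eq_single _ m.toNat fun j hj => by
      rw [if_neg (by omega), if_neg (by omega)]; simp]
    rw [if_neg (by omega), if_pos (by omega), Int.toNat_of_nonneg hm]
    simp

theorem one_normal (A : VertexOperator ℂ V) : oneField V ⋆ A = A := by
  refine field_ext fun m => LinearMap.ext fun v => ?_
  simp only [mode_nprod_apply, prodTerm_neg_one, mode_oneField, koszul]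
  rw [finsum_eq_single _ 0]
  · simp
  · intro j hj
    rw [if_neg (by omega), if_neg (by omega)]
    simp

end EvenProducts

section OPE

variable {V : Type*} [AddCommGroup V] [Module ℂ V]
  {A B C E E' F F' G : VertexOperator ℂ V}

/-- The OPE `A(z)C(0) ∼ F / z² + E / z`, encoded by the commutators of the modes of `A` and `C`, so
that at least one of the two fields is taken to be even. -/
def HasOPE (A C E F : VertexOperator ℂ V) : Prop :=
  ∀ p k : ℤ, ⁅mode A p, mode C k⁆ = mode E (p + k) + (p : ℂ) • mode F (p + k - 1)

/-- The OPE of `A` and `C`, at least one of them even, is regular. -/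
abbrev IsRegular (A C : VertexOperator ℂ V) : Prop := HasOPE A C 0 0

theorem isRegular_iff_lie : IsRegular A C ↔ ∀ p k, ⁅mode A p, mode C k⁆ = 0 := by
  simp [HasOPE]

theorem lie_mode (q : ZMod 2) (A C : VertexOperator ℂ V) (p k : ℤ) :
    ⁅mode A p, mode C k⁆ = mode (nprod 0 q 0 (shift p A) C) k := by
  simp [mode_nprod_zero, mode_shift, koszul, Ring.lie_def]

theorem hasOPE_iff (q : ZMod 2) : HasOPE A C E F ↔
    ∀ p : ℤ, nprod 0 q 0 (shift p A) C = shift p E + (p : ℂ) • shift (p - 1) F := by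
  have hmode : ∀ p k : ℤ, mode (shift p E + (p : ℂ) • shift (p - 1) F) k =
      mode E (p + k) + (p : ℂ) • mode F (p + k - 1) := fun p k => by
    simp only [mode_add, mode_smul, mode_shift, add_comm k, sub_add_eq_add_sub]
  simp only [HasOPE, lie_mode q, ← hmode]
  exact forall_congr' fun p => ⟨field_ext, fun h k => by rw [h]⟩

namespace HasOPE

theorem add_right (hB : HasOPE A B E F) (hC : HasOPE A C E' F') :
    HasOPE A (B + C) (E + E') (F + F') := (hasOPE_iff 0).2 fun p => by
  rw [nprod_add_right, (hasOPE_iff 0).1 hB, (hasOPE_iff 0).1 hC, map_add, map_add]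
  module

theorem smul_right (t : ℂ) (h : HasOPE A C E F) : HasOPE A (t • C) (t • E) (t • F) :=
  (hasOPE_iff 0).2 fun p => by
    rw [nprod_smul_right, (hasOPE_iff 0).1 h, map_smul, map_smul]
    module

theorem neg_right (h : HasOPE A C E F) : HasOPE A (-C) (-E) (-F) := fun p k => by
  have := h p k
  rw [Ring.lie_def] at this ⊢
  rw [mode_neg, mode_neg, mode_neg, mul_neg, neg_mul, smul_neg, ← neg_add, ← this]
  abel

theorem sub_right (hB : HasOPE A B E F) (hC : HasOPE A C E' F') :
    HasOPE A (B - C) (E - E') (F - F') := by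
  simpa only [sub_eq_add_neg] using hB.add_right hC.neg_right

theorem zero_right (A : VertexOperator ℂ V) : IsRegular A 0 := fun p k => by
  simp [Ring.lie_def]

theorem sum_right {ι : Type*} (s : Finset ι) {B E F : ι → VertexOperator ℂ V}
    (h : ∀ i, HasOPE A (B i) (E i) (F i)) :
    HasOPE A (∑ i ∈ s, B i) (∑ i ∈ s, E i) (∑ i ∈ s, F i) := by
  induction s using Finset.cons_induction with
  | empty => exact zero_right A
  | cons i s hi ih => simpa only [Finset.sum_cons] using (h i).add_right ih

theorem skew (h : HasOPE A C E F) : HasOPE C A (deriv F - E) F := fun p k => by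
  have := h k p
  rw [Ring.lie_def] at this ⊢
  rw [← neg_sub, this, mode_sub, mode_deriv, add_comm k]
  module

theorem skew_simple (h : HasOPE A C E 0) : HasOPE C A (-E) 0 := by
  have := h.skew
  rwa [deriv_zero, zero_sub] at this

theorem one_right (A : VertexOperator ℂ V) : IsRegular A (oneField V) := fun p k => by
  rw [mode_oneField]
  split_ifs <;> simp [Ring.lie_def]

theorem deriv_right (h : HasOPE A C E 0) : HasOPE A (deriv C) (deriv E) E := fun p k => by
  have := h p (k - 1)
  rw [mode_zero, smul_zero, add_zero, ← add_sub_assoc, Ring.lie_def] at this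
  rw [Ring.lie_def, mode_deriv, mode_deriv, mul_smul_comm, smul_mul_assoc, ← smul_sub, this]
  module

theorem shift_one (h : HasOPE A C E F) : HasOPE (shift 1 A) C (shift 1 E + F) (shift 1 F) :=
  fun p k => by
    simp only [mode_shift, mode_add, h (p + 1) k, add_right_comm p, add_sub_cancel_right,
      sub_add_cancel]
    push_cast
    module

theorem nprod_zero (h : HasOPE A C E F) : nprod 0 0 0 A C = E := by
  simpa [shift_zero] using (hasOPE_iff 0).1 h 0

theorem nprod_one (h : HasOPE A C E F) : nprod 0 0 1 A C = F := by
  rw [← zero_add 1, nprod_succ, h.shift_one.nprod_zero, h.nprod_zero, add_sub_cancel_left]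

theorem nprod_of_two_le (h : HasOPE A C E F) {j : ℕ} (hj : 2 ≤ j) : nprod 0 0 j A C = 0 := by
  induction j, hj using Nat.le_induction generalizing A E F with
  | base =>
    rw [show ((2 : ℕ) : ℤ) = 1 + 1 from rfl, nprod_succ, h.shift_one.nprod_one, h.nprod_one,
      sub_self]
  | succ j _ ih => rw [Nat.cast_succ, nprod_succ, ih h.shift_one, ih h, map_zero, sub_zero]

theorem shift_normal (h : HasOPE A C E 0) (p : ℤ) :
    shift p A ⋆ C = shift p (A ⋆ C) + (p : ℂ) • shift (p - 1) E := by
  have hsucc : ∀ p : ℤ, shift (p + 1) A ⋆ C = shift p E + shift 1 (shift p A ⋆ C) := fun p => by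
    rw [add_comm p, ← shift_shift, nprod_shift_left, neg_add_cancel, (hasOPE_iff 0).1 h, map_zero,
      smul_zero, add_zero]
  induction p with
  | zero => simp [shift_zero]
  | succ p ih =>
    rw [hsucc, ih]
    simp only [map_add, map_smul, shift_shift, add_comm (1 : ℤ), sub_add_cancel,
      add_sub_cancel_right]
    push_cast
    module
  | pred p ih =>
    have hshift : ∀ G : VertexOperator ℂ V, G = shift (-1) (shift 1 G) := fun G => by
      rw [shift_shift, neg_add_cancel, shift_zero]
    have := hsucc (-p - 1)
    rw [sub_add_cancel, ih] at this
    rw [hshift (shift _ A ⋆ C), ← sub_eq_iff_eq_add'.2 this]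
    simp only [map_add, map_sub, map_smul, shift_shift, neg_add_eq_sub]
    push_cast
    module

theorem normal_right (hB : HasOPE A B E F) (hC : HasOPE A C E' F') (hEC : HasOPE E C G 0)
    (hFC : IsRegular F C) :
    HasOPE A (B ⋆ C) (E ⋆ C + B ⋆ E') (G + F ⋆ C + B ⋆ F') := by
  refine (hasOPE_iff 0).2 fun p => ?_
  have := nprod_zero_nprod 0 0 0 (-1) (shift p A) B C
  simp only [add_zero] at this
  rw [this, (hasOPE_iff 0).1 hB, (hasOPE_iff 0).1 hC]
  simp only [nprod_add_left, nprod_add_right, nprod_smul_left, nprod_smul_right,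
    nprod_shift_right, hEC.shift_normal, hFC.shift_normal, map_add, map_zero, koszul, mul_zero,
    ZMod.val_zero, pow_zero, one_smul, smul_zero, add_zero]
  module

end HasOPE

theorem IsRegular.symm (h : IsRegular A B) : IsRegular B A := by
  simpa only [neg_zero] using h.skew_simple

theorem IsRegular.smul_left (t : ℂ) (h : IsRegular A B) : IsRegular (t • A) B :=
  IsRegular.symm <| by simpa only [smul_zero] using HasOPE.smul_right t h.symm

theorem isRegular_zero_left (C : VertexOperator ℂ V) : IsRegular 0 C := (HasOPE.zero_right C).symm

theorem isRegular_one_left (C : VertexOperator ℂ V) : IsRegular (oneField V) C :=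
  (HasOPE.one_right C).symm

theorem HasOPE.neg_left (h : HasOPE A C E 0) : HasOPE (-A) C (-E) 0 := by
  have := h.skew_simple.neg_right
  rw [neg_neg, neg_zero] at this
  exact this.skew_simple

theorem IsRegular.deriv_right (h : IsRegular A B) : IsRegular A (deriv B) := by
  simpa only [deriv_zero] using HasOPE.deriv_right h

theorem HasOPE.normal_right_of_simple (hB : HasOPE A B E 0) (hC : HasOPE A C E' 0)
    (hEC : HasOPE E C G 0) : HasOPE A (B ⋆ C) (E ⋆ C + B ⋆ E') G := by
  simpa only [nprod_zero_left, nprod_zero_right, add_zero] using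
    hB.normal_right hC hEC (isRegular_zero_left C)

theorem IsRegular.normal_right (hB : IsRegular A B) (hC : HasOPE A C E 0) :
    HasOPE A (B ⋆ C) (B ⋆ E) 0 := by
  simpa only [nprod_zero_left, zero_add] using
    HasOPE.normal_right_of_simple hB hC (isRegular_zero_left C)

theorem IsRegular.nprod_right (p q : ZMod 2) (n : ℤ) (hB : IsRegular A B) (hC : IsRegular A C) :
    IsRegular A (nprod p q n B C) := by
  refine (hasOPE_iff (p + q)).2 fun s => ?_
  have hB' := (hasOPE_iff p).1 hB s
  have hC' := (hasOPE_iff q).1 hC s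
  rw [map_zero, map_zero, smul_zero, add_zero] at hB' hC'
  rw [nprod_zero_nprod, hB', hC', nprod_zero_left, nprod_zero_right]
  simp

theorem mode_zero_shift_normal (A B : VertexOperator ℂ V) (m : ℤ) :
    mode (shift m A ⋆ B) 0 = mode (B ⋆ A) m := by
  ext v
  simp only [mode_nprod_apply]
  refine finsum_congr fun j => ?_
  simp only [prodTerm_neg_one, mode_shift]
  rw [show -1 - (j : ℤ) + m = m - 1 - j by ring, add_comm (j : ℤ), zero_add,
    show (0 : ℤ) - 1 - j = -1 - j by ring, add_comm]
  simp [koszul]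

theorem HasOPE.nprod_zero_normal_left (hA : HasOPE A C E 0) (hB : HasOPE B C F 0) :
    nprod 0 0 0 (A ⋆ B) C = A ⋆ F + B ⋆ E := by
  refine field_ext fun m => ?_
  have hA' := (hasOPE_iff 0).1 hA.skew_simple m
  have hB' := (hasOPE_iff 0).1 hB.skew_simple m
  have hAB := nprod_zero_nprod 0 0 0 (-1) (shift m C) A B
  rw [map_zero, smul_zero, add_zero] at hA' hB'
  simp only [add_zero, hA', hB', show koszul 0 0 = 1 from rfl, one_smul] at hAB
  have hcomm := lie_mode 0 C (A ⋆ B) m 0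
  rw [Ring.lie_def, hAB, mode_add, mode_zero_shift_normal, nprod_shift_right, mode_shift,
    zero_add] at hcomm
  rw [mode_nprod_zero, show koszul 0 0 = 1 from rfl, one_smul, ← neg_sub, hcomm,
    nprod_neg_right, nprod_neg_right, mode_neg, mode_neg, mode_add]
  abel

end OPE

section StressOPE

variable {V : Type*} [AddCommGroup V] [Module ℂ V]
  {T B C E P P' : VertexOperator ℂ V} {Δ w : ℂ}

/-- The OPE `T(z)C(0) ∼ P / z³ + w C / z² + ∂C / z` of even fields: `C` has weight `w` for `T`, and
`P` is its anomaly, the obstruction to `C` being primary. -/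
structure HasStressOPE (T : VertexOperator ℂ V) (w : ℂ) (C P : VertexOperator ℂ V) : Prop where
  nprod_zero : nprod 0 0 0 T C = deriv C
  nprod_one : nprod 0 0 1 T C = w • C
  nprod_two : nprod 0 0 2 T C = P
  nprod_of_three_le (j : ℕ) (hj : 3 ≤ j) : nprod 0 0 j T C = 0

theorem HasOPE.hasStressOPE (h : HasOPE T C (deriv C) (w • C)) : HasStressOPE T w C 0 where
  nprod_zero := h.nprod_zero
  nprod_one := h.nprod_one
  nprod_two := h.nprod_of_two_le le_rfl
  nprod_of_three_le _ hj := h.nprod_of_two_le (le_of_lt hj)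

namespace HasStressOPE

theorem add (hB : HasStressOPE T w B P) (hC : HasStressOPE T w C P') :
    HasStressOPE T w (B + C) (P + P') where
  nprod_zero := by rw [nprod_add_right, hB.nprod_zero, hC.nprod_zero, deriv_add]
  nprod_one := by rw [nprod_add_right, hB.nprod_one, hC.nprod_one, smul_add]
  nprod_two := by rw [nprod_add_right, hB.nprod_two, hC.nprod_two]
  nprod_of_three_le j hj := by
    rw [nprod_add_right, hB.nprod_of_three_le j hj, hC.nprod_of_three_le j hj, add_zero]

theorem neg (h : HasStressOPE T w C P) : HasStressOPE T w (-C) (-P) where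
  nprod_zero := by rw [nprod_neg_right, h.nprod_zero, deriv_neg]
  nprod_one := by rw [nprod_neg_right, h.nprod_one, smul_neg]
  nprod_two := by rw [nprod_neg_right, h.nprod_two]
  nprod_of_three_le j hj := by rw [nprod_neg_right, h.nprod_of_three_le j hj, neg_zero]

theorem sub (hB : HasStressOPE T w B P) (hC : HasStressOPE T w C P') :
    HasStressOPE T w (B - C) (P - P') := by
  simpa only [sub_eq_add_neg] using hB.add hC.neg

theorem nprod_of_two_le (hB : HasStressOPE T Δ B 0) {j : ℕ} (hj : 2 ≤ j) : nprod 0 0 j T B = 0 := by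
  obtain rfl | hj := hj.eq_or_lt
  · exact hB.nprod_two
  · exact hB.nprod_of_three_le j hj

theorem nprod_succ_normal (hB : HasStressOPE T Δ B 0) (m : ℕ) (C : VertexOperator ℂ V) :
    nprod 0 0 (m + 1) T (B ⋆ C) =
      ((m + 1) * Δ - m) • nprod 0 0 (m - 1) B C + B ⋆ nprod 0 0 (m + 1) T C := by
  have h := nprod_nprod 0 0 0 (m + 1) (-1) T B C
  rw [Finset.sum_range_succ', Finset.sum_range_succ', Finset.sum_eq_zero fun i _ => by
    rw [add_zero, hB.nprod_of_two_le (Nat.le_add_left 2 i), nprod_zero_left, smul_zero]] at h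
  simp only [Nat.cast_zero, zero_add, add_zero, Nat.choose_zero_right, one_smul,
    hB.nprod_zero, hB.nprod_one, nprod_smul_left, koszul, mul_zero, ZMod.val_zero, pow_zero,
    Nat.choose_one_right, Nat.cast_succ, sub_zero, neg_add_cancel_comm_assoc,
    nprod_deriv_left] at h
  rw [h]
  module

theorem normal (hB : HasStressOPE T Δ B 0) (hC : HasStressOPE T w C P) (hBC : HasOPE B C E 0) :
    HasStressOPE T (Δ + w) (B ⋆ C) (B ⋆ P + (2 * Δ - 1) • E) where
  nprod_zero := by
    rw [deriv_normal, ← hB.nprod_zero, ← hC.nprod_zero]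
    simpa [koszul] using nprod_zero_nprod 0 0 0 (-1) T B C
  nprod_one := by
    have := hB.nprod_succ_normal 0 C
    rw [Nat.cast_zero, zero_add, zero_sub, hC.nprod_one, nprod_smul_right] at this
    rw [this]
    push_cast
    module
  nprod_two := by
    have := hB.nprod_succ_normal 1 C
    rw [Nat.cast_one, sub_self, hBC.nprod_zero, show (1 : ℤ) + 1 = 2 from rfl,
      hC.nprod_two] at this
    rw [this]
    push_cast
    module
  nprod_of_three_le j hj := by
    obtain ⟨j, rfl⟩ := Nat.exists_eq_add_of_le' hj
    have hBC' : nprod 0 0 ((j + 1 : ℕ) : ℤ) B C = 0 := by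
      rcases j with - | j
      · exact hBC.nprod_one
      · exact hBC.nprod_of_two_le (Nat.le_add_left 2 j)
    have := hB.nprod_succ_normal (j + 2) C
    rw [← Nat.cast_succ, hC.nprod_of_three_le _ (Nat.le_add_left 3 j),
      show ((j + 2 : ℕ) : ℤ) - 1 = (j + 1 : ℕ) by push_cast; ring, hBC', smul_zero,
      nprod_zero_right, add_zero] at this
    exact this

end HasStressOPE

end StressOPE

section SymplecticPairs

variable {V : Type*} [AddCommGroup V] [Module ℂ V]
  {A B C E E' F G O T X Y : VertexOperator ℂ V} {a b s w : ℂ}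

/-- A symplectic boson pair: `X` and `Y` are bosonic, with `X(z)Y(0) ∼ 1 / z`. -/
structure IsSymplecticPair (X Y : VertexOperator ℂ V) : Prop where
  regular_left : IsRegular X X
  regular_right : IsRegular Y Y
  hasOPE : HasOPE X Y (oneField V) 0

/-- The current `-XY` of a symplectic boson pair. -/
noncomputable def current (X Y : VertexOperator ℂ V) : VertexOperator ℂ V := -(X ⋆ Y)

/-- Twice the stress tensor of a symplectic boson pair. -/
noncomputable def pairStress (X Y : VertexOperator ℂ V) : VertexOperator ℂ V :=
  X ⋆ deriv Y - deriv X ⋆ Y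

/-- The covariant derivative `O ↦ 2 (A O) + (X (Y O))` of a symplectic boson pair with current
`A = -XY`. -/
noncomputable def pairD (X Y : VertexOperator ℂ V) : VertexOperator ℂ V →ₗ[ℂ] VertexOperator ℂ V :=
  nprodBilin 0 0 (-1) (current X Y) + nprodBilin 0 0 (-1) X ∘ₗ nprodBilin 0 0 (-1) Y +
    nprodBilin 0 0 (-1) (current X Y)

theorem pairD_apply (X Y O : VertexOperator ℂ V) :
    pairD X Y O = current X Y ⋆ O + X ⋆ Y ⋆ O + current X Y ⋆ O :=
  rfl

theorem HasOPE.current_right (hX : HasOPE B X (a • oneField V) 0)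
    (hY : HasOPE B Y (b • oneField V) 0) : HasOPE B (current X Y) (-(a • Y + b • X)) 0 := by
  simpa only [current, nprod_smul_left, nprod_smul_right, one_normal, normal_one, neg_zero] using
    (hX.normal_right_of_simple hY ((isRegular_one_left Y).smul_left a)).neg_right

theorem HasOPE.deriv_right_of_one (h : HasOPE A C (a • oneField V) 0) :
    HasOPE A (deriv C) 0 (a • oneField V) := by
  have := h.deriv_right
  rwa [deriv_smul, deriv_oneField, smul_zero] at this

theorem HasOPE.pairStress_right (hX : HasOPE B X (a • oneField V) 0)
    (hY : HasOPE B Y (b • oneField V) 0) :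
    HasOPE B (pairStress X Y) (a • deriv Y - b • deriv X) (b • X - a • Y) := by
  have hXY := hX.normal_right hY.deriv_right_of_one ((isRegular_one_left (deriv Y)).smul_left a)
    (isRegular_zero_left (deriv Y))
  have hYX := hX.deriv_right_of_one.normal_right hY (isRegular_zero_left Y)
    ((isRegular_one_left Y).smul_left a)
  simpa only [pairStress, nprod_smul_left, nprod_smul_right, nprod_zero_left, nprod_zero_right,
    one_normal, normal_one, add_zero, zero_add] using hXY.sub_right hYX

theorem IsRegular.current_right (hX : IsRegular B X) (hY : IsRegular B Y) :
    IsRegular B (current X Y) := by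
  simpa only [current, neg_zero] using (hX.nprod_right 0 0 (-1) hY).neg_right

theorem IsRegular.pairD_right (hX : IsRegular B X) (hY : IsRegular B Y) (hO : HasOPE B O E 0) :
    HasOPE B (pairD X Y O) (pairD X Y E) 0 := by
  have hA : HasOPE B (current X Y ⋆ O) (current X Y ⋆ E) 0 :=
    (hX.current_right hY).normal_right hO
  simpa only [add_zero, pairD_apply] using
    (hA.add_right (hX.normal_right (hY.normal_right hO))).add_right hA

theorem normal_residue_sub_normal_residue (hO : HasOPE (current X Y) O (s • O) 0)
    (hX : HasOPE X O E 0) (hY : HasOPE Y O F 0) (hs : s * s = 1) (hE : s • E = -E)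
    (hF : s • F = F) : Y ⋆ E - X ⋆ F = O := by
  have hsO : s • O = -(X ⋆ F + Y ⋆ E) := by
    rw [← hO.nprod_zero, current, nprod_neg_left, hX.nprod_zero_normal_left hY]
  calc Y ⋆ E - X ⋆ F = s • -(X ⋆ F + Y ⋆ E) := by
        rw [smul_neg, smul_add, ← nprod_smul_right, ← nprod_smul_right, hE, hF, nprod_neg_right]
        abel
    _ = O := by rw [← hsO, smul_smul, hs, one_smul]

namespace IsSymplecticPair

theorem hasOPE_left (h : IsSymplecticPair X Y) :
    HasOPE X X ((0 : ℂ) • oneField V) 0 ∧ HasOPE X Y ((1 : ℂ) • oneField V) 0 := by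
  rw [zero_smul, one_smul]
  exact ⟨h.regular_left, h.hasOPE⟩

theorem hasOPE_right (h : IsSymplecticPair X Y) :
    HasOPE Y X ((-1 : ℂ) • oneField V) 0 ∧ HasOPE Y Y ((0 : ℂ) • oneField V) 0 := by
  rw [zero_smul, neg_one_smul_field]
  exact ⟨h.hasOPE.skew_simple, h.regular_right⟩

theorem current_left (h : IsSymplecticPair X Y) : HasOPE (current X Y) X X 0 := by
  simpa using (h.hasOPE_left.1.current_right h.hasOPE_left.2).skew_simple

theorem current_right (h : IsSymplecticPair X Y) : HasOPE (current X Y) Y (-Y) 0 := by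
  simpa [neg_one_smul_field] using
    (h.hasOPE_right.1.current_right h.hasOPE_right.2).skew_simple

theorem current_current (h : IsSymplecticPair X Y) :
    HasOPE (current X Y) (current X Y) 0 (-oneField V) := by
  have := (h.current_left.normal_right_of_simple h.current_right h.hasOPE).neg_right
  rwa [nprod_neg_right, add_neg_cancel, neg_zero] at this

theorem left_pairStress (h : IsSymplecticPair X Y) : HasOPE X (pairStress X Y) (-deriv X) X := by
  simpa using h.hasOPE_left.1.pairStress_right h.hasOPE_left.2

theorem right_pairStress (h : IsSymplecticPair X Y) : HasOPE Y (pairStress X Y) (-deriv Y) Y := by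
  simpa [neg_one_smul_field] using h.hasOPE_right.1.pairStress_right h.hasOPE_right.2

theorem current_pairD (h : IsSymplecticPair X Y) (hO : HasOPE (current X Y) O (s • O) 0)
    (hX : HasOPE X O E 0) (hY : HasOPE Y O F 0) (hs : s * s = 1) (hE : s • E = -E)
    (hF : s • F = F) : HasOPE (current X Y) (pairD X Y O) (s • pairD X Y O) 0 := by
  have hA : HasOPE (current X Y) (current X Y ⋆ O) (s • (current X Y ⋆ O)) (-O) := by
    have := h.current_current.normal_right hO (isRegular_zero_left O)
      (by simpa only [neg_zero] using (isRegular_one_left O).neg_left)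
    simpa only [nprod_neg_left, nprod_smul_right, nprod_zero_left, nprod_zero_right, one_normal,
      zero_add, add_zero] using this
  have hYO := h.current_right.normal_right_of_simple hO hY.neg_left
  have hXYO := h.hasOPE.normal_right_of_simple hX (isRegular_one_left O)
  have hXY : HasOPE (current X Y) (X ⋆ Y ⋆ O) (s • (X ⋆ Y ⋆ O)) (O + O) := by
    have := h.current_left.normal_right hYO hXYO (isRegular_zero_left _)
    rwa [nprod_zero_left, add_zero, nprod_add_right, nprod_neg_left, nprod_neg_right,
      nprod_neg_right, nprod_smul_right, nprod_smul_right, add_neg_cancel_left, one_normal,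
      add_assoc, ← sub_eq_add_neg, normal_residue_sub_normal_residue hO hX hY hs hE hF] at this
  have := (hA.add_right hXY).add_right hA
  rwa [neg_add_cancel_left, add_neg_cancel, ← smul_add, ← smul_add, ← pairD_apply] at this

theorem stress_pairD (h : IsSymplecticPair X Y) (hO : HasOPE (current X Y) O (s • O) 0)
    (hX : HasOPE X O E 0) (hY : HasOPE Y O F 0) (hTX : HasStressOPE T (1 / 2) X 0)
    (hTY : HasStressOPE T (1 / 2) Y 0) (hTO : HasStressOPE T w O 0) :
    HasStressOPE T (w + 1) (pairD X Y O) ((2 * s) • O) := by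
  have hTA : HasStressOPE T 1 (current X Y) 0 := by
    convert (hTX.normal hTY h.hasOPE).neg using 1
    · norm_num
    · rfl
    · norm_num [nprod_zero_right]
  have hXYO := h.hasOPE.normal_right_of_simple hX (isRegular_one_left O)
  have hA : HasStressOPE T (w + 1) (current X Y ⋆ O) (s • O) := by
    convert hTA.normal hTO hO using 1
    · exact add_comm w 1
    · norm_num [nprod_zero_right]
  have hXY : HasStressOPE T (w + 1) (X ⋆ Y ⋆ O) 0 := by
    convert hTX.normal (hTY.normal hTO hY) hXYO using 1
    · ring
    · norm_num [nprod_zero_right]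
  have := (hA.add hXY).add hA
  rwa [add_zero, ← two_smul ℂ, smul_smul] at this

end IsSymplecticPair

end SymplecticPairs

section FreeField

variable {V : Type*} [AddCommGroup V] [Module ℂ V] {cre ann cre' ann' : ℕ → Module.End ℂ V}
  {hann : ∀ v, ∃ N : ℕ, ∀ r, N ≤ r → ann r v = 0} {hann' : ∀ v, ∃ N : ℕ, ∀ r, N ≤ r → ann' r v = 0}

theorem mode_freeField_ofNat (r : ℕ) : mode (freeField cre ann hann) (Int.ofNat r) = ann r :=
  mode_ofModes _ _ _

theorem mode_freeField_negSucc (r : ℕ) : mode (freeField cre ann hann) (Int.negSucc r) = cre r :=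
  mode_ofModes _ _ _

theorem IsRegular.of_commute {A C : VertexOperator ℂ V}
    (h : ∀ p k, Commute (mode A p) (mode C k)) : IsRegular A C :=
  isRegular_iff_lie.2 fun p k => commute_iff_lie_eq.1 (h p k)

theorem isRegular_freeField (hcc : ∀ r s, Commute (cre r) (cre' s))
    (hca : ∀ r s, Commute (cre r) (ann' s)) (hac : ∀ r s, Commute (ann r) (cre' s))
    (haa : ∀ r s, Commute (ann r) (ann' s)) :
    IsRegular (freeField cre ann hann) (freeField cre' ann' hann') :=
  .of_commute fun
    | .ofNat r, .ofNat s => by simpa only [mode_freeField_ofNat] using haa r s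
    | .ofNat r, .negSucc s => by
      simpa only [mode_freeField_ofNat, mode_freeField_negSucc] using hac r s
    | .negSucc r, .ofNat s => by
      simpa only [mode_freeField_ofNat, mode_freeField_negSucc] using hca r s
    | .negSucc r, .negSucc s => by simpa only [mode_freeField_negSucc] using hcc r s

theorem isRegular_freeField_neg_right {hann : ∀ v, ∃ N : ℕ, ∀ r, N ≤ r → ann r v = 0}
    {hann' : ∀ v, ∃ N : ℕ, ∀ r, N ≤ r → -ann' r v = 0}
    (hcc : ∀ r s, Commute (cre r) (cre' s))
    (hca : ∀ r s, Commute (cre r) (ann' s)) (hac : ∀ r s, Commute (ann r) (cre' s))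
    (haa : ∀ r s, Commute (ann r) (ann' s)) :
    IsRegular (freeField cre ann hann) (freeField cre' (fun r => -ann' r) hann') :=
  isRegular_freeField hcc (fun r s => (hca r s).neg_right) hac fun r s => (haa r s).neg_right

theorem isRegular_freeField_neg_neg {hann : ∀ v, ∃ N : ℕ, ∀ r, N ≤ r → -ann r v = 0}
    {hann' : ∀ v, ∃ N : ℕ, ∀ r, N ≤ r → -ann' r v = 0}
    (hcc : ∀ r s, Commute (cre r) (cre' s))
    (hca : ∀ r s, Commute (cre r) (ann' s)) (hac : ∀ r s, Commute (ann r) (cre' s))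
    (haa : ∀ r s, Commute (ann r) (ann' s)) :
    IsRegular (freeField cre (fun r => -ann r) hann) (freeField cre' (fun r => -ann' r) hann') :=
  isRegular_freeField_neg_right hcc hca (fun r s => (hac r s).neg_left)
    fun r s => (haa r s).neg_left

theorem hasOPE_freeField {hann' : ∀ v, ∃ N : ℕ, ∀ r, N ≤ r → -ann' r v = 0}
    (hcc : ∀ r s, Commute (cre r) (cre' s)) (haa : ∀ r s, Commute (ann r) (ann' s))
    (hac : ∀ r s, ann r * cre' s = cre' s * ann r + if r = s then 1 else 0)
    (hca : ∀ r s, ann' r * cre s = cre s * ann' r + if r = s then 1 else 0) :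
    HasOPE (freeField cre ann hann) (freeField cre' (fun r => -ann' r) hann') (oneField V) 0 :=
  fun p k => by
    rw [mode_zero, smul_zero, add_zero, mode_oneField, Ring.lie_def]
    rcases p with r | r <;> rcases k with s | s
    · rw [mode_freeField_ofNat, mode_freeField_ofNat, mul_neg, neg_mul, (haa r s).eq, sub_self,
        if_neg (by simp only [Int.ofNat_eq_natCast]; omega)]
    · rw [mode_freeField_ofNat, mode_freeField_negSucc, hac, add_sub_cancel_left]
      exact if_congr (by simp only [Int.ofNat_eq_natCast]; omega) rfl rfl
    · rw [mode_freeField_ofNat, mode_freeField_negSucc, mul_neg, neg_mul, neg_sub_neg, hca,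
        add_sub_cancel_left]
      exact if_congr (by simp only [Int.ofNat_eq_natCast]; omega) rfl rfl
    · rw [mode_freeField_negSucc, mode_freeField_negSucc, (hcc r s).eq, sub_self, if_neg (by omega)]

end FreeField

section FockFields

variable {n : ℕ}

theorem commute_bosCre (s t : BosMode n) : Commute (bosCre s) (bosCre t) := by
  rw [Commute, SemiconjBy, bosCre, bosCre, ← LinearMap.rTensor_mul, ← LinearMap.rTensor_mul]
  exact congrArg _ (LinearMap.ext (mul_left_comm _ _))

theorem pderiv_comm {σ R : Type*} [CommRing R] (s t : σ) (f : MvPolynomial σ R) :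
    MvPolynomial.pderiv s (MvPolynomial.pderiv t f) =
      MvPolynomial.pderiv t (MvPolynomial.pderiv s f) := by
  classical
  have : ⁅MvPolynomial.pderiv (R := R) s, MvPolynomial.pderiv t⁆ = 0 :=
    MvPolynomial.derivation_ext fun i => by
      rw [Derivation.commutator_apply, MvPolynomial.pderiv_X, MvPolynomial.pderiv_X]
      simp [Pi.single_apply, apply_ite]
  exact sub_eq_zero.1 (DFunLike.congr_fun this f)

theorem commute_bosAnn (s t : BosMode n) : Commute (bosAnn s) (bosAnn t) := by
  rw [Commute, SemiconjBy, bosAnn, bosAnn, ← LinearMap.rTensor_mul, ← LinearMap.rTensor_mul]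
  exact congrArg _ (LinearMap.ext (pderiv_comm s t))

open Classical in
theorem bosAnn_mul_bosCre (s t : BosMode n) :
    bosAnn s * bosCre t = bosCre t * bosAnn s + if s = t then 1 else 0 := by
  rw [bosAnn, bosCre, ← LinearMap.rTensor_mul, ← LinearMap.rTensor_mul]
  refine TensorProduct.ext' fun f x => ?_
  split_ifs with h
  · simp [h, TensorProduct.add_tmul, add_comm]
  · simp [MvPolynomial.pderiv_X_of_ne (Ne.symm h)]

theorem commute_bosAnn_bosCre {s t : BosMode n} (h : s ≠ t) : Commute (bosAnn s) (bosCre t) := by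
  rw [Commute, SemiconjBy, bosAnn_mul_bosCre, if_neg h]
  exact add_zero _

theorem commute_lTensor_rTensor {R M N : Type*} [CommRing R] [AddCommGroup M] [Module R M]
    [AddCommGroup N] [Module R N] (g : Module.End R N) (f : Module.End R M) :
    Commute (LinearMap.lTensor M g : Module.End R (M ⊗[R] N)) (LinearMap.rTensor N f) := by
  rw [Commute, SemiconjBy, Module.End.mul_eq_comp, Module.End.mul_eq_comp,
    LinearMap.rTensor_comp_lTensor, LinearMap.lTensor_comp_rTensor]

theorem commute_heisAnn {d : Module.End ℂ (Fock n)} (hd : ∀ b r, Commute (bosAnn (.h b r)) d)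
    (a : Fin (n - 1)) : ∀ r, Commute (heisAnn a r) d
  | 0 => Commute.zero_left d
  | r + 1 => Commute.sum_left _ _ _ fun b _ => (hd b r).smul_left _

theorem isRegular_fieldX_fieldX (i j : Fin n) : IsRegular (fieldX i) (fieldX j) :=
  isRegular_freeField (fun _ _ => commute_bosCre _ _)
    (fun _ _ => (commute_bosAnn_bosCre (by simp)).symm)
    (fun _ _ => commute_bosAnn_bosCre (by simp)) fun _ _ => commute_bosAnn _ _

theorem isRegular_fieldY_fieldY (i j : Fin n) : IsRegular (fieldY i) (fieldY j) :=
  isRegular_freeField_neg_neg (fun _ _ => commute_bosCre _ _)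
    (fun _ _ => (commute_bosAnn_bosCre (by simp)).symm)
    (fun _ _ => commute_bosAnn_bosCre (by simp)) fun _ _ => commute_bosAnn _ _

theorem isRegular_fieldX_fieldY {i j : Fin n} (h : i ≠ j) : IsRegular (fieldX i) (fieldY j) :=
  isRegular_freeField_neg_right (fun _ _ => commute_bosCre _ _)
    (fun _ _ => (commute_bosAnn_bosCre (by simp [h.symm])).symm)
    (fun _ _ => commute_bosAnn_bosCre (by simp [h])) fun _ _ => commute_bosAnn _ _

theorem isSymplecticPair_fieldX_fieldY (i : Fin n) : IsSymplecticPair (fieldX i) (fieldY i) where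
  regular_left := isRegular_fieldX_fieldX i i
  regular_right := isRegular_fieldY_fieldY i i
  hasOPE := hasOPE_freeField (fun _ _ => commute_bosCre _ _) (fun _ _ => commute_bosAnn _ _)
    (fun _ _ => by simp [bosAnn_mul_bosCre]) fun _ _ => by simp [bosAnn_mul_bosCre]

theorem isRegular_fieldH_fieldX (a : Fin (n - 1)) (i : Fin n) : IsRegular (fieldH a) (fieldX i) :=
  isRegular_freeField (fun _ _ => commute_bosCre _ _)
    (fun _ _ => (commute_bosAnn_bosCre (by simp)).symm)
    (fun _ _ => commute_heisAnn (fun _ _ => commute_bosAnn_bosCre (by simp)) _ _)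
    fun _ _ => commute_heisAnn (fun _ _ => commute_bosAnn _ _) _ _

theorem isRegular_fieldH_fieldY (a : Fin (n - 1)) (i : Fin n) : IsRegular (fieldH a) (fieldY i) :=
  isRegular_freeField_neg_right (fun _ _ => commute_bosCre _ _)
    (fun _ _ => (commute_bosAnn_bosCre (by simp)).symm)
    (fun _ _ => commute_heisAnn (fun _ _ => commute_bosAnn_bosCre (by simp)) _ _)
    fun _ _ => commute_heisAnn (fun _ _ => commute_bosAnn _ _) _ _

theorem isRegular_fieldB_fieldX (a : Fin (n - 1)) (i : Fin n) : IsRegular (fieldB a) (fieldX i) :=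
  isRegular_freeField (fun _ _ => commute_lTensor_rTensor _ _)
    (fun _ _ => commute_lTensor_rTensor _ _) (fun _ _ => commute_lTensor_rTensor _ _)
    fun _ _ => commute_lTensor_rTensor _ _

theorem isRegular_fieldC_fieldX (a : Fin (n - 1)) (i : Fin n) : IsRegular (fieldC a) (fieldX i) :=
  isRegular_freeField (fun _ _ => commute_lTensor_rTensor _ _)
    (fun _ _ => commute_lTensor_rTensor _ _) (fun _ _ => commute_lTensor_rTensor _ _)
    fun _ _ => commute_lTensor_rTensor _ _

theorem isRegular_fieldB_fieldY (a : Fin (n - 1)) (i : Fin n) : IsRegular (fieldB a) (fieldY i) :=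
  isRegular_freeField_neg_right (fun _ _ => commute_lTensor_rTensor _ _)
    (fun _ _ => commute_lTensor_rTensor _ _) (fun _ _ => commute_lTensor_rTensor _ _)
    fun _ _ => commute_lTensor_rTensor _ _

theorem isRegular_fieldC_fieldY (a : Fin (n - 1)) (i : Fin n) : IsRegular (fieldC a) (fieldY i) :=
  isRegular_freeField_neg_right (fun _ _ => commute_lTensor_rTensor _ _)
    (fun _ _ => commute_lTensor_rTensor _ _) (fun _ _ => commute_lTensor_rTensor _ _)
    fun _ _ => commute_lTensor_rTensor _ _

end FockFields

section StressTensor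

variable {n : ℕ} {A Z : VertexOperator ℂ (Fock n)} {j : Fin n}

theorem IsRegular.stressH_right (h : ∀ a, IsRegular A (fieldH a)) : IsRegular A (stressH n) := by
  simpa only [stressH, smul_zero, Finset.sum_const_zero] using
    (HasOPE.sum_right Finset.univ fun a => HasOPE.sum_right Finset.univ fun b =>
      ((h a).nprod_right 0 0 (-1) (h b)).smul_right ((cartan n)⁻¹ a b)).smul_right (1 / 2)

theorem IsRegular.stressBC_right (hB : ∀ a, IsRegular A (fieldB a))
    (hC : ∀ a, IsRegular A (fieldC a)) : IsRegular A (stressBC n) := by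
  simpa only [stressBC, neg_zero, Finset.sum_const_zero] using
    (HasOPE.sum_right Finset.univ fun a =>
      (hB a).nprod_right 1 1 (-1) (hC a).deriv_right).neg_right

theorem HasOPE.stressSB_right (hj : HasOPE Z (pairStress (fieldX j) (fieldY j)) (-deriv Z) Z)
    (hX : ∀ i ≠ j, IsRegular Z (fieldX i)) (hY : ∀ i ≠ j, IsRegular Z (fieldY i)) :
    HasOPE Z (stressSB n) ((1 / 2 : ℂ) • -deriv Z) ((1 / 2 : ℂ) • Z) := by
  have hi : ∀ i, HasOPE Z (pairStress (fieldX i) (fieldY i)) (if i = j then -deriv Z else 0)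
      (if i = j then Z else 0) := fun i => by
    split_ifs with hij
    · exact hij ▸ hj
    · simpa only [pairStress, sub_zero] using
        ((hX i hij).nprod_right 0 0 (-1) (hY i hij).deriv_right).sub_right
          ((hX i hij).deriv_right.nprod_right 0 0 (-1) (hY i hij))
  simpa only [stressSB, pairStress, Finset.sum_ite_eq', Finset.mem_univ, if_true] using
    (HasOPE.sum_right Finset.univ hi).smul_right (1 / 2)

theorem HasStressOPE.of_hasOPE_pairStress
    (hj : HasOPE Z (pairStress (fieldX j) (fieldY j)) (-deriv Z) Z)
    (hX : ∀ i ≠ j, IsRegular Z (fieldX i)) (hY : ∀ i ≠ j, IsRegular Z (fieldY i))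
    (hH : ∀ a, IsRegular Z (fieldH a)) (hB : ∀ a, IsRegular Z (fieldB a))
    (hC : ∀ a, IsRegular Z (fieldC a)) : HasStressOPE (stressTensor n) (1 / 2) Z 0 := by
  have h : HasOPE Z (stressTensor n) ((1 / 2 : ℂ) • -deriv Z) ((1 / 2 : ℂ) • Z) := by
    simpa only [stressTensor, add_zero] using
      ((hj.stressSB_right hX hY).add_right (IsRegular.stressH_right hH)).add_right
        (IsRegular.stressBC_right hB hC)
  refine HasOPE.hasStressOPE ?_
  convert h.skew using 1
  rw [deriv_smul, smul_neg, sub_neg_eq_add, ← add_smul, add_halves, one_smul]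

theorem hasStressOPE_fieldX (j : Fin n) : HasStressOPE (stressTensor n) (1 / 2) (fieldX j) 0 :=
  .of_hasOPE_pairStress (isSymplecticPair_fieldX_fieldY j).left_pairStress
    (fun _ _ => isRegular_fieldX_fieldX _ _) (fun _ h => isRegular_fieldX_fieldY h.symm)
    (fun _ => (isRegular_fieldH_fieldX _ _).symm) (fun a => (isRegular_fieldB_fieldX a j).symm)
    (fun a => (isRegular_fieldC_fieldX a j).symm)

theorem hasStressOPE_fieldY (j : Fin n) : HasStressOPE (stressTensor n) (1 / 2) (fieldY j) 0 :=
  .of_hasOPE_pairStress (isSymplecticPair_fieldX_fieldY j).right_pairStress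
    (fun _ h => (isRegular_fieldX_fieldY h).symm) (fun _ _ => isRegular_fieldY_fieldY _ _)
    (fun _ => (isRegular_fieldH_fieldY _ _).symm) (fun a => (isRegular_fieldB_fieldY a j).symm)
    (fun a => (isRegular_fieldC_fieldY a j).symm)

end StressTensor

section BRST

variable {n : ℕ} {O : VertexOperator ℂ (Fock n)} {w : ℂ}

theorem HasStressOPE.isPrimary {T : VertexOperator ℂ (Fock n)} (h : HasStressOPE T w O 0) :
    IsPrimary T w O :=
  ⟨h.nprod_zero, h.nprod_one, fun _ => h.nprod_of_two_le⟩

theorem IsRegular.brst_eq_zero (h : IsRegular O (brstCurrent n)) : brst 0 O = 0 :=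
  field_ext fun k => by
    have := h.symm 0 k
    rw [mode_zero, mode_zero, smul_zero, add_zero, Ring.lie_def] at this
    rw [brst, mode_nprod_zero, show koszul 1 0 = 1 from rfl, one_smul, this, mode_zero]

theorem brst_nprod_of_closed (hO : brst 0 O = 0) (m : ℤ) (C : VertexOperator ℂ (Fock n)) :
    brst 1 (nprod 1 0 m C O) = nprod 0 0 m (brst 1 C) O := by
  have h := nprod_zero_nprod 1 1 0 m (brstCurrent n) C O
  rw [show nprod 1 0 0 (brstCurrent n) O = 0 from hO, nprod_zero_right, smul_zero] at h
  exact h.trans (add_zero _)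

theorem BRSTEquiv.nprod {T T' : VertexOperator ℂ (Fock n)} (hT : BRSTEquiv 0 T' T)
    (hO : IsOperator 0 O) (hQ : brst 0 O = 0) (m : ℤ) :
    BRSTEquiv 0 (nprod 0 0 m T' O) (nprod 0 0 m T O) := by
  obtain ⟨C, hC, hTC⟩ := hT
  refine ⟨BosonicVOA.nprod 1 0 m C O, hC.nprod m hO, ?_⟩
  rw [← nprod_sub_left, hTC]
  exact (brst_nprod_of_closed hQ m C).symm

theorem IsPrimary.isBRSTPrimary (h : IsPrimary (stressTensor n) w O) (hO : IsOperator 0 O)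
    (hQ : brst 0 O = 0) : IsBRSTPrimary n w O where
  mem := hO
  closed := hQ
  first_order _ _ hT := h.first_order ▸ hT.nprod hO hQ 0
  second_order _ _ hT := h.second_order ▸ hT.nprod hO hQ 1
  higher_order _ _ hT j hj := h.higher_order j hj ▸ hT.nprod hO hQ j

end BRST

section Charged

variable {n : ℕ} {s w : ℂ} {S S' : Set (Fin n)} {O : VertexOperator ℂ (Fock n)}

theorem isOperator_gaugeA (i : Fin n) : IsOperator 0 (gaugeA i) := by
  have := ((IsOperator.X i).nprod (-1) (IsOperator.Y i)).smul (-1)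
  rwa [neg_one_smul_field] at this

theorem isRegular_gaugeA_fieldX {l i : Fin n} (h : l ≠ i) : IsRegular (gaugeA l) (fieldX i) :=
  ((isRegular_fieldX_fieldX i l).current_right (isRegular_fieldX_fieldY h.symm)).symm

theorem isRegular_gaugeA_fieldY {l i : Fin n} (h : l ≠ i) : IsRegular (gaugeA l) (fieldY i) :=
  ((isRegular_fieldX_fieldY h).symm.current_right (isRegular_fieldY_fieldY i l)).symm

theorem IsOperator.covD (hO : IsOperator 0 O) (i : Fin n) : IsOperator 0 (covD i O) :=
  have hA : IsOperator 0 (normal 0 0 (gaugeA i) O) := (isOperator_gaugeA i).nprod (-1) hO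
  (hA.add ((IsOperator.X i).nprod (-1) ((IsOperator.Y i).nprod (-1) hO))).add hA

/-- The properties of `𝒳` (with `s = 1`) and `𝒴` (with `s = -1`) that are inherited along the
operators `D_i - D_j`: `O` is primary of weight `w`, has charge `s` for every `𝒜_l` and is regular
with the Heisenberg currents and the ghosts `c^a`. For `l ∈ S`, the bosons `X_l` and `Y_l` have at
most simple poles with `O`, where `s • E = -E` makes `X_l` regular if `s = 1`, and `s • F = F` makes
`Y_l` regular if `s = -1`. -/
structure IsCharged (s w : ℂ) (S : Set (Fin n)) (O : VertexOperator ℂ (Fock n)) : Prop where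
  mem : IsOperator 0 O
  mul_self : s * s = 1
  exists_hasOPE : ∀ l ∈ S, ∃ E F, HasOPE (fieldX l) O E 0 ∧ HasOPE (fieldY l) O F 0 ∧
    s • E = -E ∧ s • F = F
  charge : ∀ l, HasOPE (gaugeA l) O (s • O) 0
  heis : ∀ a, IsRegular (fieldH a) O
  ghost : ∀ a, IsRegular (fieldC a) O
  stress : HasStressOPE (stressTensor n) w O 0

/-- The difference `D_i - D_j` of covariant derivatives as a linear map. -/
noncomputable def covDiff (i j : Fin n) :
    VertexOperator ℂ (Fock n) →ₗ[ℂ] VertexOperator ℂ (Fock n) :=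
  pairD (fieldX i) (fieldY i) - pairD (fieldX j) (fieldY j)

theorem covDiff_apply (i j : Fin n) (O : VertexOperator ℂ (Fock n)) :
    covDiff i j O = covD i O - covD j O :=
  rfl

theorem HasOPE.covDiff_right {B E : VertexOperator ℂ (Fock n)} (hO : HasOPE B O E 0) {i j : Fin n}
    (hX : ∀ m, m = i ∨ m = j → IsRegular B (fieldX m))
    (hY : ∀ m, m = i ∨ m = j → IsRegular B (fieldY m)) :
    HasOPE B (covDiff i j O) (covDiff i j E) 0 := by
  have hD : ∀ m, m = i ∨ m = j → HasOPE B (covD m O) (covD m E) 0 := fun m hm =>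
    (hX m hm).pairD_right (hY m hm) hO
  simpa only [covDiff_apply, sub_zero] using (hD i (.inl rfl)).sub_right (hD j (.inr rfl))

namespace IsCharged

theorem mono (h : IsCharged s w S O) (hS : S' ⊆ S) : IsCharged s w S' O :=
  { h with exists_hasOPE := fun l hl => h.exists_hasOPE l (hS hl) }

theorem charge_covD (h : IsCharged s w S O) {i : Fin n} (hi : i ∈ S) (l : Fin n) :
    HasOPE (gaugeA l) (covD i O) (s • covD i O) 0 := by
  obtain rfl | hl := eq_or_ne l i
  · obtain ⟨E, F, hE, hF, hsE, hsF⟩ := h.exists_hasOPE l hi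
    exact (isSymplecticPair_fieldX_fieldY l).current_pairD (h.charge l) hE hF h.mul_self hsE hsF
  · have := (isRegular_gaugeA_fieldX hl).pairD_right (isRegular_gaugeA_fieldY hl) (h.charge l)
    rwa [map_smul] at this

theorem stress_covD (h : IsCharged s w S O) {i : Fin n} (hi : i ∈ S) :
    HasStressOPE (stressTensor n) (w + 1) (covD i O) ((2 * s) • O) := by
  obtain ⟨E, F, hE, hF, -, -⟩ := h.exists_hasOPE i hi
  exact (isSymplecticPair_fieldX_fieldY i).stress_pairD (h.charge i) hE hF (hasStressOPE_fieldX i)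
    (hasStressOPE_fieldY i) h.stress

theorem covDiff (h : IsCharged s w S O) {i j : Fin n} (hi : i ∈ S) (hj : j ∈ S) :
    IsCharged s (w + 1) {l ∈ S | l ≠ i ∧ l ≠ j} (covDiff i j O) where
  mem := by
    have := (h.mem.covD i).add ((h.mem.covD j).smul (-1))
    rwa [neg_one_smul_field, ← sub_eq_add_neg] at this
  mul_self := h.mul_self
  exists_hasOPE := by
    rintro l ⟨hl, hli, hlj⟩
    obtain ⟨E, F, hE, hF, hsE, hsF⟩ := h.exists_hasOPE l hl
    have hne : ∀ m, m = i ∨ m = j → l ≠ m := by rintro m (rfl | rfl) <;> assumption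
    have hX := hE.covDiff_right (fun m _ => isRegular_fieldX_fieldX l m)
      fun m hm => isRegular_fieldX_fieldY (hne m hm)
    have hY := hF.covDiff_right (fun m hm => (isRegular_fieldX_fieldY (hne m hm).symm).symm)
      fun m _ => isRegular_fieldY_fieldY l m
    exact ⟨_, _, hX, hY, by rw [← map_smul, hsE, map_neg], by rw [← map_smul, hsF]⟩
  charge l := by
    have := (h.charge_covD hi l).sub_right (h.charge_covD hj l)
    rw [sub_zero] at this
    rw [covDiff_apply]
    convert this using 1
    module
  heis a := by
    simpa only [map_zero] using (h.heis a).covDiff_right (fun m _ => isRegular_fieldH_fieldX a m)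
      fun m _ => isRegular_fieldH_fieldY a m
  ghost a := by
    simpa only [map_zero] using (h.ghost a).covDiff_right
      (fun m _ => isRegular_fieldC_fieldX a m) fun m _ => isRegular_fieldC_fieldY a m
  stress := by
    have := (h.stress_covD hi).sub (h.stress_covD hj)
    rwa [sub_self] at this

theorem brst_eq_zero (h : IsCharged s w S O) : brst 0 O = 0 := by
  refine IsRegular.brst_eq_zero ?_
  have hgauss : ∀ a, IsRegular O (gaugeA (right a) - gaugeA (left a) + fieldH a) := fun a => by
    simpa only [sub_self, add_zero] using
      ((h.charge (right a)).skew_simple.sub_right (h.charge (left a)).skew_simple).add_right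
        (h.heis a).symm
  have := HasOPE.sum_right Finset.univ fun a => (h.ghost a).symm.nprod_right 1 0 (-1) (hgauss a)
  simpa only [brstCurrent, Finset.sum_const_zero, gaugeA, neg_sub_neg] using this

theorem isPrimary_and_isBRSTPrimary (h : IsCharged s w S O) :
    IsPrimary (stressTensor n) w O ∧ IsBRSTPrimary n w O :=
  ⟨h.stress.isPrimary, h.stress.isPrimary.isBRSTPrimary h.mem h.brst_eq_zero⟩

end IsCharged

theorem diffProd_succ {k : ℕ} (i : Fin (2 * (k + 1)) → Fin n) (O : VertexOperator ℂ (Fock n)) :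
    diffProd i O = covDiff (i ⟨0, by omega⟩) (i ⟨1, by omega⟩)
      (diffProd (fun m : Fin (2 * k) => i ⟨m + 2, by omega⟩) O) := by
  simp only [diffProd, List.ofFn_succ, List.foldr_cons, covDiff_apply, Pi.sub_apply, Fin.val_succ,
    Fin.val_zero, mul_add, mul_zero, mul_one, zero_add, add_right_comm]

theorem IsCharged.diffProd (h : IsCharged s w Set.univ O) {k : ℕ} (i : Fin (2 * k) → Fin n)
    (hi : Function.Injective i) : IsCharged s (w + k) (Set.range i)ᶜ (diffProd i O) := by
  induction k with
  | zero =>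
    rw [Nat.cast_zero, add_zero]
    exact h.mono (Set.subset_univ _)
  | succ k ih =>
    let tail : Fin (2 * k) → Fin (2 * (k + 1)) := fun m => ⟨m + 2, by omega⟩
    have htail : Function.Injective tail := fun a b hab => by
      simpa [tail, Fin.ext_iff] using hab
    have hmem : ∀ m, m.val < 2 → i m ∈ (Set.range (i ∘ tail))ᶜ := by
      rintro m hm ⟨l, hl⟩
      have := congrArg Fin.val (hi hl)
      simp only [tail] at this
      omega
    rw [diffProd_succ, Nat.cast_succ, ← add_assoc]
    refine ((ih (i ∘ tail) (hi.comp htail)).covDiff (hmem _ (by simp))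
      (hmem _ (by simp))).mono fun l hl => ?_
    exact ⟨fun ⟨m, hm⟩ => hl ⟨_, hm⟩, fun h => hl ⟨_, h.symm⟩, fun h => hl ⟨_, h.symm⟩⟩

end Charged

section ListProducts

variable {V ι : Type*} [AddCommGroup V] [Module ℂ V] {Z : ι → VertexOperator ℂ V}
  {B T : VertexOperator ℂ V}

/-- The nested normally ordered product of the fields `Z i` for `i` in a list. -/
noncomputable def listProd (Z : ι → VertexOperator ℂ V) (L : List ι) : VertexOperator ℂ V :=
  L.foldr (fun i O => Z i ⋆ O) (oneField V)

theorem listProd_nil (Z : ι → VertexOperator ℂ V) : listProd Z [] = oneField V := rfl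

theorem listProd_cons (Z : ι → VertexOperator ℂ V) (i : ι) (L : List ι) :
    listProd Z (i :: L) = Z i ⋆ listProd Z L :=
  rfl

theorem isRegular_listProd (h : ∀ i, IsRegular B (Z i)) (L : List ι) :
    IsRegular B (listProd Z L) := by
  induction L with
  | nil => exact HasOPE.one_right B
  | cons i L ih => exact (h i).nprod_right 0 0 (-1) ih

theorem HasStressOPE.listProd {w : ι → ℂ} (hZ : ∀ i j, IsRegular (Z i) (Z j))
    (hT : ∀ i, HasStressOPE T (w i) (Z i) 0) (L : List ι) :
    HasStressOPE T (L.map w).sum (listProd Z L) 0 := by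
  induction L with
  | nil =>
    rw [listProd_nil, List.map_nil, List.sum_nil]
    refine HasOPE.hasStressOPE ?_
    rw [deriv_oneField, zero_smul]
    exact HasOPE.one_right T
  | cons i L ih =>
    simpa only [nprod_zero_right, smul_zero, add_zero, listProd_cons,
      List.map_cons, List.sum_cons] using
      (hT i).normal ih (isRegular_listProd (hZ i) L)

theorem HasOPE.listProd {s : ι → ℂ} (hZ : ∀ i j, IsRegular (Z i) (Z j))
    (hB : ∀ i, HasOPE B (Z i) (s i • Z i) 0) (L : List ι) :
    HasOPE B (listProd Z L) ((L.map s).sum • listProd Z L) 0 := by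
  induction L with
  | nil =>
    rw [List.map_nil, List.sum_nil, zero_smul]
    exact HasOPE.one_right B
  | cons i L ih =>
    have := (hB i).normal_right ih ((isRegular_listProd (hZ i) L).smul_left (s i))
      (isRegular_zero_left _)
    rwa [nprod_smul_left, nprod_smul_right, ← add_smul, nprod_zero_left, nprod_zero_right,
      add_zero, add_zero, ← listProd_cons, ← List.sum_cons, ← List.map_cons] at this

theorem exists_hasOPE_listProd {t : ι → ℂ} (hB : ∀ i, HasOPE B (Z i) (t i • oneField V) 0)
    (L : List ι) : ∃ E, HasOPE B (listProd Z L) E 0 := by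
  induction L with
  | nil => exact ⟨0, HasOPE.one_right B⟩
  | cons i L ih =>
    obtain ⟨E, hE⟩ := ih
    have := (hB i).normal_right hE ((isRegular_one_left _).smul_left (t i))
      (isRegular_zero_left _)
    rw [nprod_zero_left, nprod_zero_right, add_zero, add_zero] at this
    exact ⟨_, this⟩

end ListProducts

section Seeds

variable {n : ℕ} {Z : Fin n → VertexOperator ℂ (Fock n)}

theorem isOperator_listProd (hZ : ∀ i, IsOperator 0 (Z i)) (L : List (Fin n)) :
    IsOperator 0 (listProd Z L) := by
  induction L with
  | nil => exact IsOperator.one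
  | cons i L ih => exact (hZ i).nprod (-1) ih

theorem nestedProd_eq_listProd (Z : Fin n → VertexOperator ℂ (Fock n)) :
    nestedProd Z = listProd Z (List.finRange n) := by
  rw [nestedProd, listProd, List.ofFn_eq_map, List.foldr_map]

theorem HasOPE.nestedProd {B : VertexOperator ℂ (Fock n)} {s : ℂ} {l : Fin n}
    (hZ : ∀ i j, IsRegular (Z i) (Z j)) (hl : HasOPE B (Z l) (s • Z l) 0)
    (hB : ∀ i, l ≠ i → IsRegular B (Z i)) : HasOPE B (nestedProd Z) (s • nestedProd Z) 0 := by
  have hs : ∀ i, HasOPE B (Z i) ((if l = i then s else 0) • Z i) 0 := fun i => by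
    split_ifs with hi
    · exact hi ▸ hl
    · simpa only [zero_smul] using hB i hi
  have := HasOPE.listProd hZ hs (List.finRange n)
  rwa [← nestedProd_eq_listProd, ← Fin.sum_univ_def, Fintype.sum_ite_eq] at this

theorem IsCharged.nestedProd {s : ℂ} (hs : s * s = 1) (hmem : ∀ i, IsOperator 0 (Z i))
    (hZ : ∀ i j, IsRegular (Z i) (Z j))
    (hpair : ∀ l, ∃ E F, HasOPE (fieldX l) (BosonicVOA.nestedProd Z) E 0 ∧
      HasOPE (fieldY l) (BosonicVOA.nestedProd Z) F 0 ∧ s • E = -E ∧ s • F = F)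
    (hcharge : ∀ l, HasOPE (gaugeA l) (Z l) (s • Z l) 0)
    (hregular : ∀ l i, l ≠ i → IsRegular (gaugeA l) (Z i))
    (hheis : ∀ a i, IsRegular (fieldH a) (Z i)) (hghost : ∀ a i, IsRegular (fieldC a) (Z i))
    (hstress : ∀ i, HasStressOPE (stressTensor n) (1 / 2) (Z i) 0) :
    IsCharged s (n / 2) Set.univ (BosonicVOA.nestedProd Z) where
  mem := nestedProd_eq_listProd Z ▸ isOperator_listProd hmem _
  mul_self := hs
  exists_hasOPE l _ := hpair l
  charge l := HasOPE.nestedProd hZ (hcharge l) (hregular l)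
  heis a := nestedProd_eq_listProd Z ▸ isRegular_listProd (hheis a) _
  ghost a := nestedProd_eq_listProd Z ▸ isRegular_listProd (hghost a) _
  stress := by
    have := HasStressOPE.listProd hZ hstress (List.finRange n)
    rw [← nestedProd_eq_listProd, ← Fin.sum_univ_def] at this
    simpa [div_eq_mul_inv] using this

theorem isCharged_calX : IsCharged 1 (n / 2) Set.univ (calX n) := by
  refine .nestedProd (one_mul 1) IsOperator.X isRegular_fieldX_fieldX (fun l => ?_)
    (fun l => ?_) (fun _ _ h => isRegular_gaugeA_fieldX h) isRegular_fieldH_fieldX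
    isRegular_fieldC_fieldX hasStressOPE_fieldX
  · have hY : ∀ i, HasOPE (fieldY l) (fieldX i) ((if l = i then -1 else 0 : ℂ) • oneField _) 0 :=
      fun i => by
        split_ifs with h
        · exact h ▸ (isSymplecticPair_fieldX_fieldY l).hasOPE_right.1
        · simpa only [zero_smul] using (isRegular_fieldX_fieldY (Ne.symm h)).symm
    obtain ⟨F, hF⟩ := exists_hasOPE_listProd hY (List.finRange n)
    rw [nestedProd_eq_listProd]
    exact ⟨0, F, isRegular_listProd (isRegular_fieldX_fieldX l) _, hF,
      (smul_zero 1).trans neg_zero.symm, one_smul ℂ F⟩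
  · rw [one_smul]
    exact (isSymplecticPair_fieldX_fieldY l).current_left

theorem isCharged_calY : IsCharged (-1) (n / 2) Set.univ (calY n) := by
  refine .nestedProd (by norm_num) IsOperator.Y isRegular_fieldY_fieldY (fun l => ?_)
    (fun l => ?_) (fun _ _ h => isRegular_gaugeA_fieldY h) isRegular_fieldH_fieldY
    isRegular_fieldC_fieldY hasStressOPE_fieldY
  · have hX : ∀ i, HasOPE (fieldX l) (fieldY i) ((if l = i then 1 else 0 : ℂ) • oneField _) 0 :=
      fun i => by
        split_ifs with h
        · exact h ▸ (isSymplecticPair_fieldX_fieldY l).hasOPE_left.2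
        · simpa only [zero_smul] using isRegular_fieldX_fieldY h
    obtain ⟨E, hE⟩ := exists_hasOPE_listProd hX (List.finRange n)
    rw [nestedProd_eq_listProd]
    exact ⟨E, 0, hE, isRegular_listProd (isRegular_fieldY_fieldY l) _, neg_one_smul_field E,
      smul_zero (-1)⟩
  · rw [neg_one_smul_field]
    exact (isSymplecticPair_fieldX_fieldY l).current_right

end Seeds

end BosonicVOA

open BosonicVOA in
theorem mainTheorem5 (n k : ℕ) (hkn : 2 * k ≤ n) (i : Fin (2 * k) → Fin n)
    (hi : Function.Injective i) :
    (IsPrimary (stressTensor n) ((n : ℂ) / 2 + k) (diffProd i (calX n)) ∧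
      IsBRSTPrimary n ((n : ℂ) / 2 + k) (diffProd i (calX n))) ∧
    (IsPrimary (stressTensor n) ((n : ℂ) / 2 + k) (diffProd i (calY n)) ∧
      IsBRSTPrimary n ((n : ℂ) / 2 + k) (diffProd i (calY n))) :=
  ⟨(isCharged_calX.diffProd i hi).isPrimary_and_isBRSTPrimary,
    (isCharged_calY.diffProd i hi).isPrimary_and_isBRSTPrimary⟩
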